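/- **Setting.** Let $\mathbb{R}_+=[0,\infty)$. For each $i\in\mathbb N$ let $\mathbb R^{n_i}$ and $\mathbb R^{m_i}$ carry arbitrary norms, all written $|\cdot|$; let $I_i\subset\mathbb N$ be a finite (possibly empty) set with $i\notin I_i$; and let $f_i:\mathbb R^{n_i}\times\prod_{j\in I_i}\mathbb R^{n_j}\times\mathbb R^{m_i}\to\mathbb R^{n_i}$ be continuous. The subsystems are $\dot x_i=f_i(x_i,\bar x_i,u_i)$ with $\bar x_i=(x_j)_{j\in I_i}$. Let $$X=\{x=(x_i)_i: x_i\in\mathbb R^{n_i},\ \|x\|_X:=\sup_i|x_i|<\infty\},\qquad U=\{u=(u_i)_i: u_i\in\mathbb R^{m_i},\ \|u\|_U:=\sup_i|u_i|<\infty\},$$ and let $\mathcal U$ be the set of $u\in L_\infty(\mathbb R_+,U)$ that are piecewise right-continuous: $\mathbb R_+$ is a union of consecutive intervals $[0,a_1),[a_1,a_2),\dots$ on each of which $u$ is continuous. Its norm is $\|u\|_{\mathcal U}=\operatorname{ess\,sup}_{t\ge0}\|u(t)\|_U$. The network is $\Sigma:\ \dot x=f(x,u)$ with $f(x,u)=(f_i(x_i,\bar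 x_i,u_i))_i$. A *solution* on $[0,T)$, $0<T\le\infty$, for the initial value $x^0\in X$ and input $u\in\mathcal U$ is a function $\phi:[0,T)\to X$ such that $s\mapsto f(\phi(s),u(s))$ is an $X$-valued locally Bochner integrable function and $\phi(t)=x^0+\int_0^t f(\phi(s),u(s))\,ds$ for all $t\in[0,T)$. $\Sigma$ is *well-posed* if for all $x^0\in X$, $u\in\mathcal U$ a solution exists on some $[0,T)$ with $T>0$ and any two solutions agree on their common interval of definition; the solution is then written $\phi(\cdot,x^0,u)$. $\Sigma$ has the *BIC property* (boundedness implies continuation) if every bounded solution on $[0,T)$ with $T<\infty$ extends to a solution on $[0,T')$ for some $T'>T$. $\Sigma$ is *forward complete* if every solution extends to a solution on $[0,\infty)$. $\mathcal P$ is the set of continuous $\alpha:\mathbb R_+\to\mathbb R_+$ with $\alpha(0)=0$ and $\alpha(r)>0$ for $r>0$; $\mathcal K$ the set of continuous strictly increasing $\alpha:\mathbb R_+\to\mathbb R_+$ with $\alpha(0)=0$; $\mathcal K_\infty$ the set of unbounded functions in $\mathcal K$; $\mathcal{KL}$ the set of $\beta:\mathbb R_+^2\to\mathbb R_+$ with $\beta(\cdot,t)\in\mathcal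 K$ for every $t\ge0$ and $\beta(s,\cdot)$ continuous and strictly decreasing to $0$ for every $s>0$. A well-posed $\Sigma$ is *input-to-state stable* (ISS) if it is forward complete and there are $\beta\in\mathcal{KL}$, $\kappa\in\mathcal K$ with $\|\phi(t,x,u)\|_X\le\beta(\|x\|_X,t)+\kappa(\|u\|_{\mathcal U})$ for all $x\in X$, $u\in\mathcal U$, $t\ge0$. A function $V:X\to\mathbb R_+$ is an *ISS Lyapunov function* (in implication form) for $\Sigma$ if it is continuous, there are $\psi_1,\psi_2\in\mathcal K_\infty$ with $\psi_1(\|x\|_X)\le V(x)\le\psi_2(\|x\|_X)$ for all $x\in X$, and there are $\gamma\in\mathcal K$, $\alpha\in\mathcal P$ such that for all $x\in X$, $u\in\mathcal U$ $$V(x)>\gamma(\|u\|_{\mathcal U})\ \Longrightarrow\ \limsup_{t\to0^+}\frac{V(\phi(t,x,u))-V(x)}{t}\le-\alpha(V(x)).$$ Let $\ell_\infty^+$ be the cone of componentwise nonnegative sequences in the Banach space $\ell_\infty$ of bounded real sequences. A *monotone, homogeneous aggregation function* (MHAF) is a map $\mu:\ell_\infty^+\to[0,\infty]$ such that, for all $r,s\in\ell_\infty^+$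 and $c\ge0$: $\mu(cs)=c\mu(s)$ (with $0\cdot\infty=0$), $r\le s$ implies $\mu(r)\le\mu(s)$, and $\mu(r+s)\le\mu(r)+\mu(s)$. **Theorem.** Assume the following. (i) $\Sigma$ is well-posed and has the BIC property. (ii) For every $i\in\mathbb N$ there are a continuous $V_i:\mathbb R^{n_i}\to\mathbb R_+$ that is $C^1$ on $\mathbb R^{n_i}\setminus\{0\}$, functions $\psi_{i1},\psi_{i2}\in\mathcal K_\infty$ with $\psi_{i1}(|x_i|)\le V_i(x_i)\le\psi_{i2}(|x_i|)$ for all $x_i\in\mathbb R^{n_i}$, an MHAF $\mu_i$, numbers $\gamma_{ij}\ge0$ ($j\in\mathbb N$) with $\gamma_{ij}=0$ for $j\notin I_i$, and $\gamma_{iu}\in\mathcal K$, $\alpha_i\in\mathcal P$ such that for all $x\in X$, $u\in U$ $$V_i(x_i)>\max\bigl\{\mu_i\bigl((\gamma_{ij}V_j(x_j))_{j\in\mathbb N}\bigr),\gamma_{iu}(|u_i|)\bigr\}\ \Longrightarrow\ \nabla V_i(x_i)f_i(x_i,\bar x_i,u_i)\le-\alpha_i(V_i(x_i)).$$ Moreover,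 there are $\psi_1,\psi_2\in\mathcal K_\infty$ with $\psi_1\le\psi_{i1}$ and $\psi_{i2}\le\psi_2$ for all $i$. (iii) The gain operator $\Gamma_\mu(s):=\bigl(\mu_i((\gamma_{ij}s_j)_{j\in\mathbb N})\bigr)_{i\in\mathbb N}$ is well-defined as a map $\ell_\infty^+\to\ell_\infty^+$, and there is $\gamma^u_{\max}\in\mathcal K$ with $\gamma_{iu}\le\gamma^u_{\max}$ for all $i$. (iv) $r(\Gamma_\mu):=\lim_{n\to\infty}\ \sup_{s\in\ell_\infty^+,\ \|s\|_{\ell_\infty}=1}\|\Gamma_\mu^n(s)\|_{\ell_\infty}^{1/n}<1$. (v) For each $R>0$ there is $L(R)>0$ such that $|V_i(x_i)-V_i(y_i)|\le L(R)|x_i-y_i|$ for all $i\in\mathbb N$ and all $x_i,y_i\in\mathbb R^{n_i}$ with $|x_i|,|y_i|<R$. (vi) There is $\tilde\alpha\in\mathcal P$ with $\alpha_i\ge\tilde\alpha$ for all $i$. Then there is $s^0$ in the interior of $\ell_\infty^+$ (in $\ell_\infty$) such that $$V(x):=\sup_{i\in\mathbb N}\frac1{s^0_i}V_i(x_i),\qquad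 x\in X,$$ is finite for all $x\in X$, is an ISS Lyapunov function for $\Sigma$, and satisfies a Lipschitz condition on every bounded subset of $X$. In particular, $\Sigma$ is ISS. -/

import Mathlib

open scoped NNReal ENNReal Topology
open MeasureTheory Filter Set

noncomputable section

namespace InfNet

/-! ### Comparison functions -/

/-- Class `𝒫`: continuous positive definite functions `ℝ₊ → ℝ₊`. -/
def IsClassP (α : ℝ≥0 → ℝ≥0) : Prop :=
  Continuous α ∧ α 0 = 0 ∧ ∀ r, 0 < r → 0 < α r

/-- Class `𝒦`. -/
def IsClassK (α : ℝ≥0 → ℝ≥0) : Prop :=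
  Continuous α ∧ StrictMono α ∧ α 0 = 0

/-- Class `𝒦_∞`. -/
def IsClassKinf (α : ℝ≥0 → ℝ≥0) : Prop :=
  IsClassK α ∧ Tendsto α atTop atTop

/-- Class `ℒ`: continuous, strictly decreasing, tending to `0`. -/
def IsClassL (σ : ℝ≥0 → ℝ≥0) : Prop :=
  Continuous σ ∧ StrictAnti σ ∧ Tendsto σ atTop (𝓝 0)

/-- Class `𝒦ℒ`. -/
def IsClassKL (β : ℝ≥0 → ℝ≥0 → ℝ≥0) : Prop :=
  (∀ t, IsClassK fun s => β s t) ∧ ∀ s, 0 < s → IsClassL (β s)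

/-! ### The positive cone of `ℓ_∞` and aggregation functions -/

/-- The Banach space `ℓ_∞` of bounded real sequences with the supremum norm. -/
abbrev EllInf : Type := lp (fun _ : ℕ => ℝ) ∞

/-- The positive cone `ℓ_∞⁺`. -/
def posCone : Set EllInf := {s | ∀ i, 0 ≤ s i}

instance : Add posCone :=
  ⟨fun r s => ⟨(r : EllInf) + (s : EllInf), fun i => add_nonneg (r.2 i) (s.2 i)⟩⟩

instance : SMul ℝ≥0 posCone :=
  ⟨fun c s => ⟨(c : ℝ) • (s : EllInf), fun i => mul_nonneg c.2 (s.2 i)⟩⟩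

/-- The `i`-th component of an element of the positive cone. -/
def coord (s : posCone) (i : ℕ) : ℝ≥0 := ⟨(s : EllInf) i, s.2 i⟩

/-- A nonnegative sequence with an upper bound, as an element of the positive cone. -/
def ofBounded (a : ℕ → ℝ≥0) (h : ∃ C : ℝ≥0, ∀ i, a i ≤ C) : posCone :=
  ⟨⟨fun i => (a i : ℝ), by
      refine memℓp_infty ?_
      obtain ⟨C, hC⟩ := h
      refine ⟨(C : ℝ), ?_⟩
      rintro _ ⟨i, rfl⟩
      simpa using hC i⟩,
    fun i => (a i).2⟩

/-- The sequence `(g_j s_j)_j` for a finitely supported weight `g`. -/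
def weighted (g : ℕ →₀ ℝ≥0) (s : ℕ → ℝ≥0) : posCone :=
  ofBounded (fun j => g j * s j) (by
    refine ⟨∑ j ∈ g.support, g j * s j, fun i => ?_⟩
    by_cases hi : i ∈ g.support
    · exact Finset.single_le_sum (f := fun j => g j * s j) (fun _ _ => zero_le) hi
    · simp [Finsupp.notMem_support_iff.mp hi])

/-- Monotone, homogeneous (and subadditive) aggregation functions `ℓ_∞⁺ → [0, ∞]`. -/
structure IsMHAF (μ : posCone → ℝ≥0∞) : Prop where
  homogeneous : ∀ (c : ℝ≥0) (s : posCone), μ (c • s) = c * μ s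
  monotone : ∀ r s : posCone, (∀ i, coord r i ≤ coord s i) → μ r ≤ μ s
  subadditive : ∀ r s : posCone, μ (r + s) ≤ μ r + μ s

/-! ### The gain operator and its spectral radius -/

/-- The components `μ_i ((γ_ij s_j)_j) ∈ [0, ∞]` of the gain operator. -/
def gainMap (μ : ℕ → posCone → ℝ≥0∞) (γ : ℕ → ℕ →₀ ℝ≥0) (s : posCone) (i : ℕ) : ℝ≥0∞ :=
  μ i (weighted (γ i) (coord s))

/-- The gain operator is well-defined: it maps `ℓ_∞⁺` to (finite) bounded sequences. -/
def GainWellDefined (μ : ℕ → posCone → ℝ≥0∞) (γ : ℕ → ℕ →₀ ℝ≥0) : Prop :=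
  ∀ s : posCone, ∃ C : ℝ≥0, ∀ i, gainMap μ γ s i ≤ C

/-- The gain operator `Γ_μ : ℓ_∞⁺ → ℓ_∞⁺`. -/
def gainOperator (μ : ℕ → posCone → ℝ≥0∞) (γ : ℕ → ℕ →₀ ℝ≥0) (h : GainWellDefined μ γ) :
    posCone → posCone := fun s =>
  ofBounded (fun i => (gainMap μ γ s i).toNNReal) (by
    obtain ⟨C, hC⟩ := h s
    exact ⟨C, fun i => (ENNReal.toNNReal_mono ENNReal.coe_ne_top (hC i)).trans_eq (ENNReal.toNNReal_coe C)⟩)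

/-- `r` is the spectral radius of `T`, that is
`r = lim_{n → ∞} sup {‖T^n s‖^{1/n} | s ∈ ℓ_∞⁺, ‖s‖ = 1}`. -/
def IsSpectralRadius (T : posCone → posCone) (r : ℝ≥0∞) : Prop :=
  Tendsto (fun n : ℕ =>
      ⨆ s ∈ {s : posCone | ‖(s : EllInf)‖ = 1}, ‖(T^[n] s : EllInf)‖ₑ ^ (1 / (n : ℝ)))
    atTop (𝓝 r)

/-! ### Networks and their solutions -/

/-- A countable family of control systems `ẋ_i = f_i(x_i, x̄_i, u_i)`, where `x̄_i` collects the
states `x_j` with `j` in the finite set `nbr i`. -/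
structure Network (E F : ℕ → Type*) [∀ i, NormedAddCommGroup (E i)]
    [∀ i, NormedAddCommGroup (F i)] where
  nbr : ℕ → Finset ℕ
  self_notMem : ∀ i, i ∉ nbr i
  f : ∀ i, E i × (∀ j : nbr i, E j) × F i → E i
  continuous_f : ∀ i, Continuous (f i)

/-- The interval `[0, T)`, `0 ≤ T ≤ ∞`. -/
def timeInterval (T : ℝ≥0∞) : Set ℝ := {t | 0 ≤ t ∧ ENNReal.ofReal t < T}

/-- Piecewise right-continuous functions on `ℝ₊`. -/
def PiecewiseRightContinuous {Y : Type*} [TopologicalSpace Y] (u : ℝ → Y) : Prop :=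
  ∃ a : ℕ → ℝ, a 0 = 0 ∧ StrictMono a ∧ Tendsto a atTop atTop ∧
    ∀ n, ContinuousOn u (Ico (a n) (a (n + 1)))

/-- Admissible external inputs: essentially bounded and piecewise right-continuous functions
on `ℝ₊` (values at negative times are irrelevant). -/
def IsInput {Y : Type*} [NormedAddCommGroup Y] (u : ℝ → Y) : Prop :=
  MemLp u ∞ (volume.restrict (Ici 0)) ∧ PiecewiseRightContinuous u

/-- The `L_∞(ℝ₊)`-norm of an input. -/
def inputNorm {Y : Type*} [NormedAddCommGroup Y] (u : ℝ → Y) : ℝ≥0 :=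
  (eLpNorm u ∞ (volume.restrict (Ici 0))).toNNReal

namespace Network

variable {E F : ℕ → Type*} [∀ i, NormedAddCommGroup (E i)] [∀ i, NormedAddCommGroup (F i)]

/-- The right-hand side `f(x, u) = (f_i(x_i, x̄_i, u_i))_i ∈ ∏ E_i` of the interconnection. -/
def rhs (N : Network E F) (x : lp E ∞) (u : lp F ∞) (i : ℕ) : E i :=
  N.f i (x i, fun j => x j, u i)

variable [∀ i, NormedSpace ℝ (E i)]

/-- `φ` is a solution on `[0, T)` of `ẋ = f(x, u)`, `x(0) = x₀`: the function
`s ↦ f(φ(s), u(s))` is `X`-valued and locally Bochner integrable on `[0, T)`, and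
`φ(t) = x₀ + ∫₀ᵗ f(φ(s), u(s)) ds`. -/
def IsSolution (N : Network E F) (x₀ : lp E ∞) (u : ℝ → lp F ∞) (T : ℝ≥0∞)
    (φ : ℝ → lp E ∞) : Prop :=
  0 < T ∧ ∃ g : ℝ → lp E ∞,
    (∀ s ∈ timeInterval T, ∀ i, g s i = N.rhs (φ s) (u s) i) ∧
    LocallyIntegrableOn g (timeInterval T) ∧
    ∀ t ∈ timeInterval T, φ t = x₀ + ∫ s in (0 : ℝ)..t, g s

/-- Local solutions exist and are unique. -/
def WellPosed (N : Network E F) : Prop :=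
  ∀ (x₀ : lp E ∞) (u : ℝ → lp F ∞), IsInput u →
    (∃ T φ, N.IsSolution x₀ u T φ) ∧
    ∀ T₁ T₂ φ₁ φ₂, N.IsSolution x₀ u T₁ φ₁ → N.IsSolution x₀ u T₂ φ₂ →
      EqOn φ₁ φ₂ (timeInterval T₁ ∩ timeInterval T₂)

/-- Boundedness-implies-continuation: a bounded solution on `[0, T)` with `T < ∞` extends to
a solution on a strictly larger interval. -/
def BIC (N : Network E F) : Prop :=
  ∀ (x₀ : lp E ∞) (u : ℝ → lp F ∞), IsInput u → ∀ T φ, T < ∞ → N.IsSolution x₀ u T φ →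
    Bornology.IsBounded (φ '' timeInterval T) →
    ∃ T' φ', T < T' ∧ N.IsSolution x₀ u T' φ' ∧ EqOn φ' φ (timeInterval T)

/-- Every solution extends to `ℝ₊`. -/
def ForwardComplete (N : Network E F) : Prop :=
  ∀ (x₀ : lp E ∞) (u : ℝ → lp F ∞), IsInput u → ∀ T φ, N.IsSolution x₀ u T φ →
    ∃ φ', N.IsSolution x₀ u ∞ φ' ∧ EqOn φ' φ (timeInterval T)

/-- Input-to-state stability. -/
def ISS (N : Network E F) : Prop :=
  N.WellPosed ∧ N.ForwardComplete ∧
    ∃ β κ, IsClassKL β ∧ IsClassK κ ∧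
      ∀ (x₀ : lp E ∞) (u : ℝ → lp F ∞), IsInput u → ∀ φ, N.IsSolution x₀ u ∞ φ →
        ∀ t : ℝ≥0, ‖φ t‖₊ ≤ β ‖x₀‖₊ t + κ (inputNorm u)

/-- The right upper Dini derivative at time `0` of `V` along `φ`, in `[-∞, ∞]`. -/
def diniDeriv (V : lp E ∞ → ℝ≥0) (φ : ℝ → lp E ∞) (x : lp E ∞) : EReal :=
  limsup (fun t : ℝ => ((((V (φ t) : ℝ) - (V x : ℝ)) / t : ℝ) : EReal)) (𝓝[>] 0)

/-- ISS Lyapunov functions in implication form. -/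
def IsISSLyapunov (N : Network E F) (V : lp E ∞ → ℝ≥0) : Prop :=
  Continuous V ∧
  (∃ ψ₁ ψ₂, IsClassKinf ψ₁ ∧ IsClassKinf ψ₂ ∧ ∀ x, ψ₁ ‖x‖₊ ≤ V x ∧ V x ≤ ψ₂ ‖x‖₊) ∧
  ∃ γ α, IsClassK γ ∧ IsClassP α ∧
    ∀ (x : lp E ∞) (u : ℝ → lp F ∞), IsInput u → γ (inputNorm u) < V x →
      ∀ T φ, N.IsSolution x u T φ → diniDeriv V φ x ≤ ((-(α (V x) : ℝ) : ℝ) : EReal)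

end Network

/-- The candidate `V(x) = sup_i V_i(x_i) / s⁰_i`. -/
def supLyapunov {E : ℕ → Type*} [∀ i, NormedAddCommGroup (E i)] (V : ∀ i, E i → ℝ≥0)
    (s₀ : posCone) (x : lp E ∞) : ℝ≥0 :=
  ⨆ i, 1 / coord s₀ i * V i (x i)

end InfNet

end

/-!
Along a solution, the supremum `V(x) = sup_i V_i(x_i) / s_i` decreases if the weights `s` are a
strict subeigenvector of the gain operator, `Γ(s) ≤ l s` with `l < 1`. Such weights exist because
the spectral radius is below `1`: then `Γ^n(1) ≤ l^n` for some `n ≥ 1`, and the finite sum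
`s = ∑_{k < n} l^{-k} Γ^k(1)` works, by homogeneity and subadditivity (`exists_decay_point`).

The supremum over infinitely many components is controlled by uniformity: solutions are
continuous in the sup norm and the `V_i` are uniformly Lipschitz on balls, so on a short time
interval every `V_i / s_i` changes by less than a small multiple of `V(x)`. Components which are
not almost maximal at the start stay irrelevant for the supremum. An almost maximal component
exceeds its gain term, which is at most `l s_i` times roughly `V(x)`, and its input term.
The subsystem estimate makes it decrease at a rate that depends on `V(x)` only, not on the
component (`Network.diniDeriv_supLyapunov_le`). Inputs are right-continuous, so the components
of a solution have right derivatives given by the vector field at every time, and no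
almost-everywhere argument is needed (`Network.IsSolution.hasDerivWithinAt`).

Input-to-state stability follows by comparison with a scalar flow `W(s, t)` that decays slower than
the Lyapunov function does. It is given explicitly by `W(s, t) = exp (H⁻¹ (H(log s) - t))`, with
`H` the time map of the scalar equation in logarithmic coordinates (`exists_timeMap`).
The resulting bound (`Network.IsISSLyapunov.exists_bound`) holds on the whole interval of existence, so that the
maximal solution, glued from all local ones, is bounded and thus global by the BIC property.
-/

open scoped NNReal ENNReal Topology
open MeasureTheory Filter Set

namespace InfNet

/-! ### Comparison functions -/

/-- A single class `𝒫` function below all values of `α'` at points comparable to `r`: take the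
minimum of `θ ↦ α' (θ r)` over the compact range of factors `θ`. -/
theorem IsClassP.exists_le_of_comparable {α' : ℝ≥0 → ℝ≥0} (h : IsClassP α') {a b : ℝ≥0}
    (ha : 0 < a) (hab : a ≤ b) :
    ∃ α, IsClassP α ∧ ∀ r w, a * r ≤ w → w ≤ b * r → α r ≤ α' w := by
  have hne : (Icc a b).Nonempty := nonempty_Icc.2 hab
  have hcont : Continuous fun r => sInf ((fun θ => α' (θ * r)) '' Icc a b) :=
    isCompact_Icc.continuous_sInf (f := fun r θ => α' (θ * r))
      (h.1.comp (continuous_snd.mul continuous_fst))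
  refine ⟨fun r => sInf ((fun θ => α' (θ * r)) '' Icc a b), ⟨hcont, ?_, fun r hr => ?_⟩,
    fun r w h1 h2 => ?_⟩
  · simp [h.2.1, hne.image_const]
  · obtain ⟨θ, hθ, he⟩ := (isCompact_Icc.image (h.1.comp
      (continuous_id.mul continuous_const) : Continuous fun θ => α' (θ * r))).sInf_mem
      (hne.image _)
    refine lt_of_lt_of_eq ?_ he
    exact h.2.2 _ (mul_pos (ha.trans_le hθ.1) hr)
  · rcases eq_or_ne r 0 with rfl | hr
    · simp [h.2.1, hne.image_const]
    · refine csInf_le (OrderBot.bddBelow _) ⟨w / r, ⟨?_, ?_⟩, ?_⟩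
      · rwa [le_div_iff₀ (pos_iff_ne_zero.2 hr)]
      · rwa [div_le_iff₀ (pos_iff_ne_zero.2 hr)]
      · simp [div_mul_cancel₀ _ hr]

theorem IsClassK.mono {α : ℝ≥0 → ℝ≥0} (h : IsClassK α) : Monotone α := h.2.1.monotone

theorem IsClassK.comp {α β : ℝ≥0 → ℝ≥0} (h : IsClassK α) (h' : IsClassK β) :
    IsClassK (fun r => α (β r)) :=
  ⟨h.1.comp h'.1, h.2.1.comp h'.2.1, by simp [h.2.2, h'.2.2]⟩

theorem IsClassK.const_mul {α : ℝ≥0 → ℝ≥0} (h : IsClassK α) {c : ℝ≥0} (hc : 0 < c) :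
    IsClassK (fun r => c * α r) :=
  ⟨continuous_const.mul h.1, fun _ _ hab => mul_lt_mul_of_pos_left (h.2.1 hab) hc,
    by simp [h.2.2]⟩

/-- A class `𝒦_∞` function is an order automorphism of `ℝ₊`, so its inverse is of class `𝒦`. -/
theorem IsClassKinf.exists_inverse {ψ : ℝ≥0 → ℝ≥0} (h : IsClassKinf ψ) :
    ∃ e : ℝ≥0 ≃o ℝ≥0, (∀ r, e r = ψ r) ∧ IsClassK e.symm := by
  have hs : Function.Surjective ψ := h.1.1.surjective h.2 (by
    simp [OrderBot.atBot_eq, h.1.2.2])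
  refine ⟨h.1.2.1.orderIsoOfSurjective ψ hs, fun r => rfl, ?_, OrderIso.strictMono _, ?_⟩
  · exact OrderIso.continuous _
  · rw [OrderIso.symm_apply_eq]
    exact h.1.2.2.symm

/-- In the logarithmic variable `y = log w`, the equation `ẇ = -min(α(w), w) / 2` becomes
`ẏ = -1 / h(y)` with `h ≥ 2`; its time map `H` (a primitive of `h`) is therefore an order
automorphism of `ℝ`, which is `C¹` with a `C¹` inverse. -/
theorem exists_timeMap {α : ℝ≥0 → ℝ≥0} (hα : IsClassP α) :
    ∃ H : ℝ ≃o ℝ, ∀ z, ∃ d : ℝ, d < α (Real.exp (H.symm z)).toNNReal ∧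
      HasDerivAt (fun z => Real.exp (H.symm z)) d z := by
  set m : ℝ → ℝ := fun y => min (α (Real.exp y).toNNReal : ℝ) (Real.exp y) with hm
  have hm_pos : ∀ y, 0 < m y := fun y =>
    lt_min (by exact_mod_cast hα.2.2 _ (by simpa using Real.exp_pos y)) (Real.exp_pos y)
  set h : ℝ → ℝ := fun y => 2 * Real.exp y / m y with hh
  have hcont : Continuous h := by
    have hαc := hα.1
    have : Continuous m := by
      have : Continuous fun y : ℝ => α (Real.exp y).toNNReal :=
        hαc.comp (continuous_real_toNNReal.comp Real.continuous_exp)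
      exact (NNReal.continuous_coe.comp this).min Real.continuous_exp
    exact (continuous_const.mul Real.continuous_exp).div this fun y => (hm_pos y).ne'
  have h_ge : ∀ y, 1 ≤ h y := fun y => by
    rw [hh, le_div_iff₀ (hm_pos y)]
    have : m y ≤ Real.exp y := min_le_right _ _
    linarith [Real.exp_pos y]
  set G : ℝ → ℝ := fun y => ∫ s in (0 : ℝ)..y, h s with hG
  have hGd : ∀ y, HasDerivAt G (h y) y := fun y => (hcont.integral_hasStrictDerivAt 0 y).hasDerivAt
  have hGc : Continuous G := continuous_iff_continuousAt.2 fun y => (hGd y).continuousAt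
  have hGm : StrictMono G := strictMono_of_deriv_pos fun y => by
    rw [(hGd y).deriv]; linarith [h_ge y]
  have hG_ge : ∀ x y, x ≤ y → y - x ≤ G y - G x := fun x y hxy => by
    have := mul_sub_le_image_sub_of_le_deriv (f := G) (C := 1)
      (fun y => (hGd y).differentiableAt) (fun y => by rw [(hGd y).deriv]; exact h_ge y) hxy
    simpa using this
  have hG0 : G 0 = 0 := by simp [hG]
  have hs : Function.Surjective G := by
    refine hGc.surjective ?_ ?_
    · refine tendsto_atTop_mono' atTop ?_ tendsto_id
      filter_upwards [eventually_ge_atTop 0] with y hy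
      simpa [hG0] using hG_ge 0 y hy
    · refine tendsto_atBot_mono' atBot ?_ tendsto_id
      filter_upwards [eventually_le_atBot 0] with y hy
      simpa [hG0] using hG_ge y 0 hy
  refine ⟨hGm.orderIsoOfSurjective G hs, fun z => ?_⟩
  set K := (hGm.orderIsoOfSurjective G hs).symm with hK
  have hGK : ∀ z, G (K z) = z := fun z => (hGm.orderIsoOfSurjective G hs).apply_symm_apply z
  have hKd : HasDerivAt K (h (K z))⁻¹ z :=
    (hGd (K z)).of_local_left_inverse K.continuous.continuousAt
      (by linarith [h_ge (K z)]) (Eventually.of_forall hGK)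
  refine ⟨_, ?_, hKd.exp⟩
  have e : Real.exp (K z) * (h (K z))⁻¹ = m (K z) / 2 := by
    have := hm_pos (K z)
    have := Real.exp_pos (K z)
    simp only [hh]
    field_simp
  rw [e]
  have h1 : m (K z) ≤ α (Real.exp (K z)).toNNReal := min_le_left _ _
  linarith [hm_pos (K z)]

/-- For every `α ∈ 𝒫` there is a `𝒦ℒ` function whose positive trajectories decrease strictly
slower than `α` prescribes. It bounds every function decaying at least at rate `α`. -/
theorem IsClassP.exists_flow {α : ℝ≥0 → ℝ≥0} (hα : IsClassP α) :
    ∃ W : ℝ≥0 → ℝ≥0 → ℝ≥0, IsClassKL W ∧ (∀ s, W s 0 = s) ∧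
      ∀ s, 0 < s → ∀ t : ℝ, 0 ≤ t → ∃ d : ℝ, d < α (W s t.toNNReal) ∧
        HasDerivWithinAt (fun τ : ℝ => (W s τ.toNNReal : ℝ)) (-d) (Ici t) t := by
  obtain ⟨H, hH⟩ := exists_timeMap hα
  set W : ℝ≥0 → ℝ≥0 → ℝ≥0 := fun s t =>
    if s = 0 then 0 else (Real.exp (H.symm (H (Real.log s) - t))).toNNReal with hW
  have hW0 : ∀ t, W 0 t = 0 := fun t => by simp [hW]
  have hWp : ∀ s t, s ≠ 0 → W s t = (Real.exp (H.symm (H (Real.log s) - t))).toNNReal :=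
    fun s t hs => by simp [hW, hs]
  have hWpos : ∀ s t, s ≠ 0 → 0 < W s t := fun s t hs => by
    rw [hWp s t hs]; simpa using Real.exp_pos _
  have hWs : ∀ s, W s 0 = s := fun s => by
    rcases eq_or_ne s 0 with rfl | hs
    · exact hW0 0
    · have : (0 : ℝ) < s := by positivity
      rw [hWp s 0 hs]
      simp [Real.exp_log this]
  have hanti : ∀ s, s ≠ 0 → StrictAnti (W s) := fun s hs t t' htt' => by
    rw [hWp s t hs, hWp s t' hs, Real.toNNReal_lt_toNNReal_iff (Real.exp_pos _), Real.exp_lt_exp]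
    apply H.symm.strictMono
    have : (t : ℝ) < t' := by exact_mod_cast htt'
    linarith
  have hle : ∀ s t, W s t ≤ s := fun s t => by
    rcases eq_or_ne s 0 with rfl | hs
    · rw [hW0]
    · exact ((hanti s hs).antitone (zero_le (a := t))).trans_eq (hWs s)
  have hlog : ∀ s : ℝ≥0, s ≠ 0 → ContinuousAt (fun s : ℝ≥0 => Real.log s) s := fun s hs =>
    (Real.continuousAt_log (by exact_mod_cast hs)).comp NNReal.continuous_coe.continuousAt
  refine ⟨W, ⟨fun t => ⟨?_, ?_, hW0 t⟩, fun s hs => ⟨?_, hanti s hs.ne', ?_⟩⟩, hWs,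
    fun s hs t ht => ?_⟩
  · refine continuous_iff_continuousAt.2 fun s => ?_
    rcases eq_or_ne s 0 with rfl | hs
    · have h0 : Tendsto (fun s => W s t) (𝓝 0) (𝓝 0) :=
        tendsto_of_tendsto_of_tendsto_of_le_of_le tendsto_const_nhds tendsto_id
          (fun s => zero_le) (fun s => hle s t)
      simpa [ContinuousAt, hW0] using h0
    · have h1 : ContinuousAt
          (fun s : ℝ≥0 => (Real.exp (H.symm (H (Real.log s) - t))).toNNReal) s := by
        have h2 : ContinuousAt (fun s : ℝ≥0 => H (Real.log s) - t) s :=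
          (H.continuous.continuousAt.comp (hlog s hs)).sub continuousAt_const
        exact (continuous_real_toNNReal.comp
          (Real.continuous_exp.comp H.symm.continuous)).continuousAt.comp h2
      refine h1.congr ?_
      filter_upwards [isOpen_ne.mem_nhds hs] with s' hs'
      exact (hWp s' t hs').symm
  · intro s s' hss'
    have hs' : s' ≠ 0 := (pos_of_gt hss').ne'
    rcases eq_or_ne s 0 with rfl | hs
    · simpa [hW0] using hWpos s' t hs'
    · show W s t < W s' t
      rw [hWp s t hs, hWp s' t hs', Real.toNNReal_lt_toNNReal_iff (Real.exp_pos _),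
        Real.exp_lt_exp]
      apply H.symm.strictMono
      have : H (Real.log s) < H (Real.log s') :=
        H.strictMono (Real.log_lt_log (by positivity) (by exact_mod_cast hss'))
      linarith
  · have : W s = fun t : ℝ≥0 => (Real.exp (H.symm (H (Real.log s) - t))).toNNReal :=
      funext fun t => hWp s t hs.ne'
    rw [this]
    exact continuous_real_toNNReal.comp (Real.continuous_exp.comp (H.symm.continuous.comp
      (continuous_const.sub NNReal.continuous_coe)))
  · have : W s = fun t : ℝ≥0 => (Real.exp (H.symm (H (Real.log s) - t))).toNNReal :=
      funext fun t => hWp s t hs.ne'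
    rw [this, ← Real.toNNReal_zero]
    refine (continuous_real_toNNReal.tendsto 0).comp (Real.tendsto_exp_atBot.comp
      (H.symm.tendsto_atBot.comp ?_))
    exact tendsto_atBot_add_const_left _ _
      (tendsto_neg_atTop_atBot.comp (NNReal.tendsto_coe_atTop.2 tendsto_id))
  · obtain ⟨d, hd, hder⟩ := hH (H (Real.log s) - t)
    refine ⟨d, ?_, ?_⟩
    · rw [hWp s _ hs.ne', Real.coe_toNNReal t ht]
      exact hd
    · have hc := hder.scomp t ((hasDerivAt_id t).const_sub (H (Real.log s)))
      have : HasDerivAt (fun τ : ℝ => Real.exp (H.symm (H (Real.log s) - τ))) (-d) t := by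
        simpa [Function.comp_def] using hc
      refine this.hasDerivWithinAt.congr (fun τ hτ => ?_) ?_
      · rw [hWp s _ hs.ne', Real.coe_toNNReal τ (ht.trans hτ),
          Real.coe_toNNReal _ (Real.exp_pos _).le]
      · rw [hWp s _ hs.ne', Real.coe_toNNReal t ht, Real.coe_toNNReal _ (Real.exp_pos _).le]

/-- Comparison with the flow of `IsClassP.exists_flow` above a threshold `r`, by continuous
induction: a continuous function which decays at rate `α` (in the sense of Dini derivatives)
wherever it exceeds `r` stays below `max (W (v 0) t) r`. -/
theorem exists_classKL_comparison {α : ℝ≥0 → ℝ≥0} (hα : IsClassP α) :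
    ∃ W : ℝ≥0 → ℝ≥0 → ℝ≥0, IsClassKL W ∧ (∀ s t, W s t ≤ s) ∧
      ∀ (v : ℝ → ℝ≥0) (r : ℝ≥0) (b : ℝ), 0 ≤ b → ContinuousOn v (Icc 0 b) →
        (∀ t ∈ Ico 0 b, r < v t →
          limsup (fun h : ℝ => ((((v (t + h) : ℝ) - (v t : ℝ)) / h : ℝ) : EReal)) (𝓝[>] 0)
            ≤ ((-(α (v t) : ℝ) : ℝ) : EReal)) →
        v b ≤ max (W (v 0) b.toNNReal) r := by
  obtain ⟨W, hW, hW0, hWd⟩ := hα.exists_flow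
  refine ⟨W, hW, fun s t => ?_, fun v r b hb hv hdini => ?_⟩
  · rcases eq_or_ne s 0 with rfl | hs
    · exact ((hW.1 t).2.2).le
    · exact ((hW.2 s (pos_iff_ne_zero.2 hs)).2.1.antitone (zero_le (a := t))).trans_eq (hW0 s)
  -- A strictly larger threshold `r'` makes the Dini bound available on the level `v = r'`.
  refine le_of_forall_gt_imp_ge_of_dense fun c hc => ?_
  obtain ⟨r', hrr', hr'c⟩ := exists_between ((le_max_right _ _).trans_lt hc)
  refine le_trans (b := max (W (v 0) b.toNNReal) r') ?_
    (max_le ((le_max_left _ _).trans hc.le) hr'c.le)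
  have hWt : ∀ s, Continuous fun t : ℝ => W s t.toNNReal := fun s => by
    rcases eq_or_ne s 0 with rfl | hs
    · have : (fun t : ℝ => W 0 t.toNNReal) = fun _ => 0 := funext fun t => (hW.1 _).2.2
      rw [this]; exact continuous_const
    · exact (hW.2 s (pos_iff_ne_zero.2 hs)).1.comp continuous_real_toNNReal
  have hB : Continuous fun t : ℝ => max (W (v 0) t.toNNReal) r' :=
    (hWt _).max continuous_const
  suffices h : Icc 0 b ⊆ {t | v t ≤ max (W (v 0) t.toNNReal) r'} from h (right_mem_Icc.2 hb)
  refine IsClosed.Icc_subset_of_forall_exists_gt ?_ ?_ ?_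
  · have := isClosed_Icc.isClosed_le hv hB.continuousOn
    rwa [inter_comm]
  · simp [hW0]
  · rintro t ⟨ht, htb⟩ y hy
    have hmin : t < min y b := lt_min hy htb.2
    suffices h : ∀ᶠ z in 𝓝[>] t, v z ≤ max (W (v 0) z.toNNReal) r' by
      obtain ⟨z, hz, hz'⟩ := (h.and (Ioc_mem_nhdsGT hmin)).exists
      exact ⟨z, hz, hz'.1, hz'.2.trans (min_le_left _ _)⟩
    rcases lt_or_eq_of_le (show v t ≤ max (W (v 0) t.toNNReal) r' from ht) with hlt | heq
    · have h1 : Tendsto v (𝓝[>] t) (𝓝 (v t)) :=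
        ((hv t ⟨htb.1, htb.2.le⟩).mono_of_mem_nhdsWithin
          (mem_of_superset (Ioc_mem_nhdsGT htb.2) fun z hz => ⟨htb.1.trans hz.1.le, hz.2⟩))
      have h2 := (hB.tendsto t).mono_left (nhdsWithin_le_nhds (s := Ioi t))
      filter_upwards [h1.eventually_lt h2 hlt] with z hz using hz.le
    · have hrv : r < v t := hrr'.trans_le ((le_max_right _ _).trans_eq heq.symm)
      have hαv : 0 < α (v t) := hα.2.2 _ (pos_of_gt hrv)
      have hD := hdini t htb hrv
      -- transfer an eventual statement in the increment `h` to the point `t + h`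
      have key : ∀ e : ℝ, e < α (v t) → ∀ᶠ z in 𝓝[>] t, (v z : ℝ) < v t - e * (z - t) := by
        intro e he
        have h1 : limsup (fun h : ℝ => ((((v (t + h) : ℝ) - (v t : ℝ)) / h : ℝ) : EReal)) (𝓝[>] 0)
            < ((-e : ℝ) : EReal) := hD.trans_lt (by
          rw [EReal.coe_lt_coe_iff]; linarith)
        have h2 := eventually_lt_of_limsup_lt h1
        have h3 : Tendsto (fun z : ℝ => z - t) (𝓝[>] t) (𝓝[>] 0) := by
          refine tendsto_nhdsWithin_iff.2 ⟨?_, ?_⟩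
          · have : Tendsto (fun z : ℝ => z - t) (𝓝 t) (𝓝 (t - t)) :=
              (continuous_id.sub continuous_const).tendsto t
            rw [sub_self] at this
            exact this.mono_left nhdsWithin_le_nhds
          · filter_upwards [self_mem_nhdsWithin] with z hz
            exact sub_pos.2 (mem_Ioi.1 hz)
        filter_upwards [h3.eventually h2, self_mem_nhdsWithin] with z hz hzt
        rw [EReal.coe_lt_coe_iff, add_sub_cancel, div_lt_iff₀ (sub_pos.2 hzt)] at hz
        linarith
      rcases le_total (W (v 0) t.toNNReal) r' with hle | hle
      · rw [max_eq_right hle] at heq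
        filter_upwards [key 0 (by exact_mod_cast hαv)] with z hz
        rw [zero_mul, sub_zero, NNReal.coe_lt_coe] at hz
        exact hz.le.trans (heq.le.trans (le_max_right _ _))
      · rw [max_eq_left hle] at heq
        have hv0 : 0 < v 0 := by
          rw [pos_iff_ne_zero]
          intro h0
          have hz : W 0 t.toNNReal = 0 := (hW.1 _).2.2
          rw [heq, h0, hz] at hrv
          exact not_lt_zero hrv
        obtain ⟨d, hd, hder⟩ := hWd (v 0) hv0 t htb.1
        rw [← heq] at hd
        obtain ⟨e, hde, heα⟩ := exists_between hd
        have hsl := (hasDerivWithinAt_iff_tendsto_slope' (self_notMem_Ioi)).1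
          (hder.mono Ioi_subset_Ici_self)
        filter_upwards [hsl.eventually_const_lt (neg_lt_neg hde), key e heα,
          self_mem_nhdsWithin] with z hz1 hz2 hz3
        rw [slope_def_field, lt_div_iff₀ (sub_pos.2 hz3), ← heq] at hz1
        have : (v z : ℝ) ≤ W (v 0) z.toNNReal := by linarith
        exact (NNReal.coe_le_coe.1 this).trans (le_max_left _ _)

/-! ### The gain operator -/

@[simp]
theorem coord_weighted (g : ℕ →₀ ℝ≥0) (s : ℕ → ℝ≥0) (i : ℕ) :
    coord (weighted g s) i = g i * s i := rfl

@[simp]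
theorem coord_add (r s : posCone) (i : ℕ) : coord (r + s) i = coord r i + coord s i := rfl

@[simp]
theorem coord_smul (c : ℝ≥0) (s : posCone) (i : ℕ) : coord (c • s) i = c * coord s i := rfl

@[ext]
theorem posCone_ext {r s : posCone} (h : ∀ i, coord r i = coord s i) : r = s :=
  Subtype.ext (lp.ext (funext fun i => congrArg NNReal.toReal (h i)))

theorem weighted_add (g : ℕ →₀ ℝ≥0) (s t : ℕ → ℝ≥0) :
    weighted g (fun j => s j + t j) = weighted g s + weighted g t := by
  ext i; simp [mul_add]

theorem weighted_const_mul (g : ℕ →₀ ℝ≥0) (c : ℝ≥0) (s : ℕ → ℝ≥0) :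
    weighted g (fun j => c * s j) = c • weighted g s := by
  ext i; simp [mul_left_comm]

theorem coord_le_norm (s : posCone) (i : ℕ) : (coord s i : ℝ) ≤ ‖(s : EllInf)‖ :=
  (le_abs_self _).trans (lp.norm_apply_le_norm ENNReal.top_ne_zero (s : EllInf) i)

section Gain

variable {μ : ℕ → posCone → ℝ≥0∞} {γ : ℕ → ℕ →₀ ℝ≥0}

theorem coe_coord_gainOperator (h : GainWellDefined μ γ) (s : posCone) (i : ℕ) :
    (coord (gainOperator μ γ h s) i : ℝ≥0∞) = gainMap μ γ s i := by
  obtain ⟨C, hC⟩ := h s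
  exact ENNReal.coe_toNNReal ((hC i).trans_lt ENNReal.coe_lt_top).ne

theorem gainMap_smul (hμ : ∀ i, IsMHAF (μ i)) (c : ℝ≥0) (s : posCone) (i : ℕ) :
    gainMap μ γ (c • s) i = c * gainMap μ γ s i := by
  simp only [gainMap]
  rw [← (hμ i).homogeneous, ← weighted_const_mul]
  rfl

theorem gainMap_add (hμ : ∀ i, IsMHAF (μ i)) (r s : posCone) (i : ℕ) :
    gainMap μ γ (r + s) i ≤ gainMap μ γ r i + gainMap μ γ s i := by
  refine le_trans (le_of_eq ?_) ((hμ i).subadditive _ _)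
  simp only [gainMap]
  rw [← weighted_add]
  rfl

theorem coord_gainOperator_smul (hμ : ∀ i, IsMHAF (μ i)) (h : GainWellDefined μ γ) (c : ℝ≥0)
    (s : posCone) (i : ℕ) :
    coord (gainOperator μ γ h (c • s)) i = c * coord (gainOperator μ γ h s) i := by
  have := gainMap_smul (γ := γ) hμ c s i
  rw [← coe_coord_gainOperator h, ← coe_coord_gainOperator h] at this
  exact_mod_cast this

theorem coord_gainOperator_add (hμ : ∀ i, IsMHAF (μ i)) (h : GainWellDefined μ γ)
    (r s : posCone) (i : ℕ) :
    coord (gainOperator μ γ h (r + s)) i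
      ≤ coord (gainOperator μ γ h r) i + coord (gainOperator μ γ h s) i := by
  have := gainMap_add (γ := γ) hμ r s i
  rw [← coe_coord_gainOperator h, ← coe_coord_gainOperator h, ← coe_coord_gainOperator h] at this
  exact_mod_cast this

/-- The constant sequence `1`, the canonical interior point of the cone. -/
def onePos : posCone := ofBounded (fun _ => 1) ⟨1, fun _ => le_rfl⟩

theorem norm_onePos : ‖(onePos : EllInf)‖ = 1 := by
  refine le_antisymm (lp.norm_le_of_forall_le zero_le_one fun i => ?_) ?_
  · show ‖(1 : ℝ)‖ ≤ 1
    simp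
  · exact coord_le_norm onePos 0

/-- Since the spectral radius is below `1`, the iterates of the gain operator on the constant
sequence `1` are eventually dominated by a geometric sequence. -/
theorem exists_iterate_le (h : GainWellDefined μ γ) {ρ : ℝ≥0∞}
    (hρ : IsSpectralRadius (gainOperator μ γ h) ρ) (hρ1 : ρ < 1) :
    ∃ l : ℝ≥0, 0 < l ∧ l < 1 ∧ ∃ n : ℕ, ∀ i,
      coord ((gainOperator μ γ h)^[n + 1] onePos) i ≤ l ^ (n + 1) := by
  obtain ⟨l, hl1, hl2⟩ := ENNReal.lt_iff_exists_nnreal_btwn.1 hρ1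
  have hl0 : 0 < l := by
    have := pos_of_gt hl1
    exact_mod_cast this
  obtain ⟨n, hn⟩ := ((tendsto_add_atTop_iff_nat 1).2 hρ |>.eventually_lt_const hl1).exists
  refine ⟨l, hl0, by exact_mod_cast hl2, n, fun i => ?_⟩
  have h1 : ‖((gainOperator μ γ h)^[n + 1] onePos : EllInf)‖ₑ ^ (1 / ((n + 1 : ℕ) : ℝ)) ≤ l :=
    (le_iSup₂ (f := fun (s : posCone) (_ : s ∈ {s : posCone | ‖(s : EllInf)‖ = 1}) =>
      ‖((gainOperator μ γ h)^[n + 1] s : EllInf)‖ₑ ^ (1 / ((n + 1 : ℕ) : ℝ))) onePos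
      norm_onePos).trans hn.le
  have hn0 : (0 : ℝ) < (n + 1 : ℕ) := by positivity
  rw [one_div, ENNReal.rpow_inv_le_iff hn0, ENNReal.rpow_natCast, ← ENNReal.coe_pow,
    enorm_eq_nnnorm, ENNReal.coe_le_coe] at h1
  exact (NNReal.coe_le_coe.1 (coord_le_norm _ i)).trans h1

/-- A subeigenvector of the gain operator: if `Γ^{n+1}(1) ≤ l^{n+1}` then
`s = ∑_{k ≤ n} l^{-k} Γ^k(1)` satisfies `Γ(s) ≤ l s`, since by subadditivity and homogeneity
`Γ(s) + l 1 ≤ l (s + l^{-(n+1)} Γ^{n+1}(1))`. No convergence of an infinite sum is involved. -/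
theorem exists_decay_point (hμ : ∀ i, IsMHAF (μ i)) (h : GainWellDefined μ γ) {ρ : ℝ≥0∞}
    (hρ : IsSpectralRadius (gainOperator μ γ h) ρ) (hρ1 : ρ < 1) :
    ∃ (s : posCone) (l : ℝ≥0), l < 1 ∧ (∀ i, 1 ≤ coord s i) ∧
      ∀ i, gainMap μ γ s i ≤ l * coord s i := by
  obtain ⟨l, hl0, hl1, n, hn⟩ := exists_iterate_le h hρ hρ1
  set Γ := gainOperator μ γ h with hΓ
  -- the partial sums `S m = ∑_{k ≤ m} l^{-k} Γ^k(1)`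
  let S : ℕ → posCone := fun m =>
    Nat.rec onePos (fun k s => s + (l⁻¹ ^ (k + 1)) • Γ^[k + 1] onePos) m
  have hS : ∀ k, S (k + 1) = S k + (l⁻¹ ^ (k + 1)) • Γ^[k + 1] onePos := fun k => rfl
  have hS1 : ∀ m i, 1 ≤ coord (S m) i := fun m i => by
    induction m with
    | zero => exact le_rfl
    | succ k ih => rw [hS, coord_add]; exact ih.trans le_self_add
  have key : ∀ m i, coord (Γ (S m)) i + l ≤
      l * coord (S m) i + l * (l⁻¹ ^ (m + 1) * coord (Γ^[m + 1] onePos) i) := fun m i => by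
    induction m with
    | zero =>
      have : coord (S 0) i = 1 := rfl
      rw [this]
      simp [mul_inv_cancel_left₀ hl0.ne', S, add_comm]
    | succ k ih =>
      rw [hS]
      have h1 := coord_gainOperator_add hμ h (S k) ((l⁻¹ ^ (k + 1)) • Γ^[k + 1] onePos) i
      rw [coord_gainOperator_smul hμ h, ← hΓ, ← Function.iterate_succ_apply' Γ] at h1
      rw [coord_add, coord_smul]
      have h2 : l * (l⁻¹ ^ (k + 1 + 1) * coord (Γ^[k + 1 + 1] onePos) i)
          = l⁻¹ ^ (k + 1) * coord (Γ^[k + 1 + 1] onePos) i := by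
        rw [pow_succ l⁻¹ (k + 1)]
        field_simp
      rw [h2, mul_add]
      calc _ ≤ coord (Γ (S k)) i + l⁻¹ ^ (k + 1) * coord (Γ^[k + 1 + 1] onePos) i + l := by gcongr
        _ = (coord (Γ (S k)) i + l) + l⁻¹ ^ (k + 1) * coord (Γ^[k + 1 + 1] onePos) i := by ring
        _ ≤ _ := by gcongr
  refine ⟨S n, l, hl1, hS1 n, fun i => ?_⟩
  rw [← coe_coord_gainOperator h, ← ENNReal.coe_mul, ENNReal.coe_le_coe]
  have h1 := key n i
  have h2 : l⁻¹ ^ (n + 1) * coord (Γ^[n + 1] onePos) i ≤ 1 := by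
    calc _ ≤ l⁻¹ ^ (n + 1) * l ^ (n + 1) := by gcongr; exact hn i
      _ = 1 := by rw [← mul_pow, inv_mul_cancel₀ hl0.ne', one_pow]
  have h3 := mul_le_mul_of_nonneg_left h2 (zero_le (a := l))
  rw [mul_one] at h3
  exact le_of_add_le_add_right (h1.trans (add_le_add_right h3 _))

/-- Bounds on the states of the neighbours are passed through the gain operator. -/
theorem aggregation_le (hμ : ∀ i, IsMHAF (μ i)) {s : posCone} {l c : ℝ≥0} {i : ℕ}
    (hs : gainMap μ γ s i ≤ l * coord s i) {w : ℕ → ℝ≥0} (hw : ∀ j, w j ≤ c * coord s j) :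
    μ i (weighted (γ i) w) ≤ (c * (l * coord s i) : ℝ≥0) := by
  calc μ i (weighted (γ i) w) ≤ μ i (c • weighted (γ i) (coord s)) := by
        refine (hμ i).monotone _ _ fun j => ?_
        rw [coord_weighted, coord_smul, coord_weighted, mul_left_comm]
        exact mul_le_mul_of_nonneg_left (hw j) zero_le
    _ = c * gainMap μ γ s i := (hμ i).homogeneous _ _
    _ ≤ _ := by
        push_cast
        gcongr

end Gain

theorem mem_interior_posCone {s : posCone} (hs : ∀ i, 1 ≤ coord s i) :
    (s : EllInf) ∈ interior posCone := by
  refine mem_interior.2 ⟨Metric.ball (s : EllInf) 1, fun y hy i => ?_, Metric.isOpen_ball,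
    Metric.mem_ball_self one_pos⟩
  have h1 : ‖(y - s : EllInf) i‖ < 1 :=
    (lp.norm_apply_le_norm ENNReal.top_ne_zero _ i).trans_lt (by simpa [dist_eq_norm] using hy)
  have h2 : (1 : ℝ) ≤ (s : EllInf) i := by exact_mod_cast hs i
  rw [lp.coeFn_sub, Pi.sub_apply, Real.norm_eq_abs, abs_lt] at h1
  linarith [h1.1]

/-! ### Inputs -/

section Inputs

variable {Y : Type*} [NormedAddCommGroup Y] {u : ℝ → Y}

theorem exists_mem_Ico_of_tendsto {a : ℕ → ℝ} (ha : Tendsto a atTop atTop) {t : ℝ}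
    (h0 : a 0 ≤ t) : ∃ n, t ∈ Ico (a n) (a (n + 1)) := by
  have hex : ∃ n, t < a n := (ha.eventually_gt_atTop t).exists
  classical
  have h1 : Nat.find hex ≠ 0 := fun h => by
    have := Nat.find_spec hex
    rw [h] at this
    exact absurd this h0.not_gt
  obtain ⟨n, hn⟩ := Nat.exists_eq_succ_of_ne_zero h1
  refine ⟨n, not_lt.1 (Nat.find_min hex (hn ▸ Nat.lt_succ_self n)), ?_⟩
  have := Nat.find_spec hex
  rwa [hn] at this

theorem IsInput.continuousWithinAt (hu : IsInput u) {t : ℝ} (ht : 0 ≤ t) :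
    ContinuousWithinAt u (Ici t) t := by
  obtain ⟨a, ha0, -, hat, hc⟩ := hu.2
  obtain ⟨n, hn⟩ := exists_mem_Ico_of_tendsto hat (ha0.trans_le ht)
  exact (hc n t hn).mono_of_mem_nhdsWithin
    (mem_of_superset (Ico_mem_nhdsGE hn.2) (Ico_subset_Ico_left hn.1))

/-- By right-continuity, the essential supremum of an input bounds all its values. -/
theorem IsInput.nnnorm_le (hu : IsInput u) {t : ℝ} (ht : 0 ≤ t) : ‖u t‖₊ ≤ inputNorm u := by
  have hfin : eLpNorm u ∞ (volume.restrict (Ici 0)) ≠ ∞ := hu.1.2.ne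
  have hae : ∀ᵐ s ∂volume.restrict (Ioi t), ‖u s‖₊ ≤ inputNorm u := by
    have h1 : ∀ᵐ s ∂volume.restrict (Ici (0 : ℝ)), ‖u s‖₊ ≤ inputNorm u := by
      filter_upwards [ae_le_eLpNormEssSup (f := u) (μ := volume.restrict (Ici (0 : ℝ)))] with s hs
      rw [← eLpNorm_exponent_top, ← ENNReal.coe_toNNReal hfin, enorm_eq_nnnorm,
        ENNReal.coe_le_coe] at hs
      exact hs
    exact ae_mono (Measure.restrict_mono (fun s hs => ht.trans (mem_Ioi.1 hs).le) le_rfl) h1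
  have hc : ContinuousWithinAt (fun s => ‖u s‖₊) (Ioi t) t :=
    ((hu.continuousWithinAt ht).mono Ioi_subset_Ici_self).nnnorm
  refine le_of_tendsto_of_frequently hc ?_
  -- otherwise the bound would fail on a whole interval `(t, b)`, which has positive measure
  rw [Filter.Frequently]
  intro hcon
  obtain ⟨b, hb, hsub⟩ := mem_nhdsGT_iff_exists_Ioo_subset.1 hcon
  rw [ae_restrict_iff' measurableSet_Ioi] at hae
  have hz : volume (Ioo t b) = 0 := by
    refine measure_mono_null (fun s hs => ?_) hae
    exact fun h => hsub hs (h hs.1)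
  rw [Real.volume_Ioo, ENNReal.ofReal_eq_zero] at hz
  linarith [mem_Ioi.1 hb]

theorem measurePreserving_add_left_restrict (t : ℝ) :
    MeasurePreserving (fun s => t + s) (volume.restrict (Ici 0)) (volume.restrict (Ici t)) := by
  have h := (measurePreserving_add_left volume t).restrict_preimage
    (measurableSet_Ici (a := t))
  have e : (fun s => t + s) ⁻¹' Ici t = Ici 0 := by ext; simp
  rwa [e] at h

theorem IsInput.shift (hu : IsInput u) {t : ℝ} (ht : 0 ≤ t) : IsInput fun s => u (t + s) := by
  refine ⟨?_, ?_⟩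
  · have h1 : MemLp u ∞ (volume.restrict (Ici t)) :=
      hu.1.mono_measure (Measure.restrict_mono (Ici_subset_Ici.2 ht) le_rfl)
    exact h1.comp_measurePreserving (measurePreserving_add_left_restrict t)
  · obtain ⟨a, ha0, ham, hat, hc⟩ := hu.2
    obtain ⟨n, hn⟩ := exists_mem_Ico_of_tendsto hat (ha0.trans_le ht)
    -- the new breakpoints are `0, a (n+1) - t, a (n+2) - t, …`
    let b : ℕ → ℝ := fun k => Nat.casesOn k 0 fun k => a (n + (k + 1)) - t
    have hbm : StrictMono b := by
      refine strictMono_nat_of_lt_succ fun k => ?_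
      cases k with
      | zero => exact sub_pos.2 hn.2
      | succ k => exact sub_lt_sub_right (ham (by omega)) t
    have hmaps : ∀ k, MapsTo (fun s => t + s) (Ico (b k) (b (k + 1)))
        (Ico (a (n + k)) (a (n + k + 1))) := by
      intro k s hs
      have h2 : s < a (n + (k + 1)) - t := hs.2
      refine ⟨?_, by rw [add_assoc]; show t + s < _; linarith⟩
      cases k with
      | zero =>
        have h1 : 0 ≤ s := hs.1
        exact hn.1.trans (by simpa using h1)
      | succ k =>
        have h1 : a (n + (k + 1)) - t ≤ s := hs.1
        show a (n + (k + 1)) ≤ t + s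
        linarith
    refine ⟨b, rfl, hbm, ?_, fun k => ?_⟩
    · rw [← tendsto_add_atTop_iff_nat 1]
      refine tendsto_atTop_add_const_right _ (-t) (hat.comp ?_)
      exact tendsto_atTop_mono (fun k => show k ≤ n + (k + 1) by omega) tendsto_id
    · exact (hc (n + k)).comp (continuous_const.add continuous_id).continuousOn (hmaps k)

theorem IsInput.inputNorm_shift_le (hu : IsInput u) {t : ℝ} (ht : 0 ≤ t) :
    inputNorm (fun s => u (t + s)) ≤ inputNorm u := by
  refine ENNReal.toNNReal_mono hu.1.2.ne ?_
  have h1 : MemLp u ∞ (volume.restrict (Ici t)) :=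
    hu.1.mono_measure (Measure.restrict_mono (Ici_subset_Ici.2 ht) le_rfl)
  have := eLpNorm_comp_measurePreserving (p := ∞) h1.1 (measurePreserving_add_left_restrict t)
  exact this.le.trans
    (eLpNorm_mono_measure u (Measure.restrict_mono (Ici_subset_Ici.2 ht) le_rfl))

end Inputs

/-! ### Solutions of the network -/

theorem isOpen_ofReal_lt (T : ℝ≥0∞) : IsOpen {t : ℝ | ENNReal.ofReal t < T} :=
  isOpen_Iio.preimage ENNReal.continuous_ofReal

theorem Icc_subset_timeInterval {T : ℝ≥0∞} {t : ℝ} (ht : t ∈ timeInterval T) :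
    Icc 0 t ⊆ timeInterval T :=
  fun _ hs => ⟨hs.1, (ENNReal.ofReal_le_ofReal hs.2).trans_lt ht.2⟩

theorem exists_gt_mem_timeInterval {T : ℝ≥0∞} {t : ℝ} (ht : t ∈ timeInterval T) :
    ∃ b ∈ timeInterval T, t < b := by
  have h : ∀ᶠ b in 𝓝[>] t, ENNReal.ofReal b < T :=
    nhdsWithin_le_nhds ((isOpen_ofReal_lt T).mem_nhds ht.2)
  obtain ⟨b, hb, hbt⟩ := (h.and self_mem_nhdsWithin).exists
  exact ⟨b, ⟨ht.1.trans (mem_Ioi.1 hbt).le, hb⟩, hbt⟩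

theorem Icc_mem_nhdsWithin_timeInterval {T : ℝ≥0∞} {t b : ℝ} (hb : t < b) :
    Icc 0 b ∈ 𝓝[timeInterval T] t := by
  filter_upwards [self_mem_nhdsWithin, nhdsWithin_le_nhds (Iio_mem_nhds hb)] with s hs hs'
  exact ⟨hs.1, (mem_Iio.1 hs').le⟩

theorem locallyIntegrableOn_timeInterval_iff {X : Type*} [NormedAddCommGroup X] {g : ℝ → X}
    {T : ℝ≥0∞} : LocallyIntegrableOn g (timeInterval T) ↔
      ∀ t ∈ timeInterval T, IntegrableOn g (Icc 0 t) := by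
  refine ⟨fun h t ht => h.integrableOn_compact_subset (Icc_subset_timeInterval ht) isCompact_Icc,
    fun h t ht => ?_⟩
  obtain ⟨b, hb, htb⟩ := exists_gt_mem_timeInterval ht
  exact ⟨_, Icc_mem_nhdsWithin_timeInterval htb, h b hb⟩

theorem zero_mem_timeInterval {T : ℝ≥0∞} (hT : 0 < T) : (0 : ℝ) ∈ timeInterval T :=
  ⟨le_rfl, by simpa using hT⟩

theorem mem_timeInterval_sub {T : ℝ≥0∞} {t s : ℝ} (ht : 0 ≤ t) (hs : 0 ≤ s) :
    s ∈ timeInterval (T - ENNReal.ofReal t) ↔ t + s ∈ timeInterval T := by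
  simp only [timeInterval, mem_ofPred_eq, lt_tsub_iff_left, ENNReal.ofReal_add ht hs, hs,
    add_nonneg ht hs, true_and]

theorem intervalIntegrable_of_timeInterval {X : Type*} [NormedAddCommGroup X] {T : ℝ≥0∞}
    {g : ℝ → X} (hg : LocallyIntegrableOn g (timeInterval T)) {a b : ℝ}
    (ha : a ∈ timeInterval T) (hb : b ∈ timeInterval T) : IntervalIntegrable g volume a b := by
  have h : ∀ t ∈ timeInterval T, IntervalIntegrable g volume 0 t := fun t ht =>
    (intervalIntegrable_iff_integrableOn_Icc_of_le ht.1).2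
      (locallyIntegrableOn_timeInterval_iff.1 hg t ht)
  exact (h a ha).symm.trans (h b hb)

theorem continuous_coord {E : ℕ → Type*} [∀ i, NormedAddCommGroup (E i)] (i : ℕ) :
    Continuous fun x : lp E ∞ => x i :=
  (lp.lipschitzWith_one_eval ∞ i).continuous

namespace Network

variable {E F : ℕ → Type*} [∀ i, NormedAddCommGroup (E i)] [∀ i, NormedAddCommGroup (F i)]
  [∀ i, NormedSpace ℝ (E i)] {N : Network E F} {x₀ : lp E ∞} {u : ℝ → lp F ∞} {T : ℝ≥0∞}
  {φ : ℝ → lp E ∞}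

theorem IsSolution.apply_zero (h : N.IsSolution x₀ u T φ) : φ 0 = x₀ := by
  obtain ⟨hT, g, -, -, hφ⟩ := h
  simpa using hφ 0 (zero_mem_timeInterval hT)

theorem IsSolution.continuousOn (h : N.IsSolution x₀ u T φ) : ContinuousOn φ (timeInterval T) := by
  obtain ⟨hT, g, -, hg, hφ⟩ := h
  intro t ht
  obtain ⟨b, hb, htb⟩ := exists_gt_mem_timeInterval ht
  have h1 : ContinuousOn (fun s => x₀ + ∫ r in (0 : ℝ)..s, g r) (Icc 0 b) :=
    continuousOn_const.add (by
      have := intervalIntegral.continuousOn_primitive_interval (a := 0) (b := b) (f := g)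
        (μ := volume) (by
          rw [uIcc_of_le hb.1]; exact locallyIntegrableOn_timeInterval_iff.1 hg b hb)
      rwa [uIcc_of_le hb.1] at this)
  have h2 : ContinuousOn φ (Icc 0 b) :=
    h1.congr fun s hs => hφ s (Icc_subset_timeInterval hb hs)
  exact (h2 t ⟨ht.1, htb.le⟩).mono_of_mem_nhdsWithin (Icc_mem_nhdsWithin_timeInterval htb)

/-- Since inputs are right-continuous, the components of a solution satisfy the differential
equation at every time, with right derivatives. -/
theorem IsSolution.hasDerivWithinAt [∀ i, CompleteSpace (E i)] (h : N.IsSolution x₀ u T φ)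
    (hu : IsInput u) {t : ℝ} (ht : t ∈ timeInterval T) (i : ℕ) :
    HasDerivWithinAt (fun s => φ s i) (N.rhs (φ t) (u t) i) (Ici t) t := by
  have hcont := h.continuousOn
  obtain ⟨hT, g, hgr, hg, hφ⟩ := h
  obtain ⟨b, hb, htb⟩ := exists_gt_mem_timeInterval ht
  have hev : Icc t b ∈ 𝓝[≥] t := Icc_mem_nhdsGE htb
  have hsub : Icc t b ⊆ timeInterval T := fun s hs =>
    Icc_subset_timeInterval hb ⟨ht.1.trans hs.1, hs.2⟩
  let P : lp E ∞ →L[ℝ] E i := lp.evalCLM ℝ E ∞ i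
  have hint : ∀ s ∈ timeInterval T, IntervalIntegrable (fun r => g r i) volume 0 s := fun s hs =>
    have h := intervalIntegrable_of_timeInterval hg (zero_mem_timeInterval hT) hs
    ⟨P.integrable_comp h.1, P.integrable_comp h.2⟩
  have hEq : ∀ s ∈ timeInterval T, φ s i = x₀ i + ∫ r in (0 : ℝ)..s, g r i := fun s hs => by
    rw [hφ s hs, lp.coeFn_add, Pi.add_apply]
    congr 1
    exact (P.intervalIntegral_comp_comm
      (intervalIntegrable_of_timeInterval hg (zero_mem_timeInterval hT) hs)).symm
  have hφt : ContinuousWithinAt φ (Ici t) t :=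
    (hcont t ht).mono_of_mem_nhdsWithin (mem_of_superset hev hsub)
  have hrc : ContinuousWithinAt (fun r => g r i) (Ici t) t := by
    have h1 : ContinuousWithinAt (fun r => N.rhs (φ r) (u r) i) (Ici t) t := by
      have hf : ContinuousAt (N.f i) (φ t i, (fun j : N.nbr i => φ t j), u t i) :=
        (N.continuous_f i).continuousAt
      refine ContinuousAt.comp_continuousWithinAt
        (f := fun r => (φ r i, (fun j : N.nbr i => φ r j), u r i)) hf ?_
      refine ContinuousWithinAt.prodMk
        ((continuous_coord i).continuousAt.comp_continuousWithinAt hφt)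
        (ContinuousWithinAt.prodMk ?_ ?_)
      · exact continuousWithinAt_pi.2 fun j =>
          (continuous_coord (j : ℕ)).continuousAt.comp_continuousWithinAt hφt
      · exact (continuous_coord i).continuousAt.comp_continuousWithinAt
          (hu.continuousWithinAt ht.1)
    refine h1.congr_of_eventuallyEq ?_ (hgr t ht i)
    filter_upwards [hev] with s hs using hgr s (hsub hs) i
  have hmeas : StronglyMeasurableAtFilter (fun r => g r i) (𝓝[>] t) := by
    refine ⟨Ioc t b, Ioc_mem_nhdsGT htb, ?_⟩
    refine (hint b hb).1.1.mono_measure (Measure.restrict_mono ?_ le_rfl)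
    exact Ioc_subset_Ioc_left ht.1
  have hder := intervalIntegral.integral_hasDerivWithinAt_right (s := Ici t) (hint t ht) hmeas
    (hrc.mono Ioi_subset_Ici_self)
  rw [hgr t ht i] at hder
  refine (hder.const_add (x₀ i)).congr_of_eventuallyEq ?_ (hEq t ht)
  filter_upwards [hev] with s hs using hEq s (hsub hs)

theorem IsSolution.shift (h : N.IsSolution x₀ u T φ) {t : ℝ} (ht : t ∈ timeInterval T) :
    N.IsSolution (φ t) (fun s => u (t + s)) (T - ENNReal.ofReal t) fun s => φ (t + s) := by
  obtain ⟨hT, g, hgr, hg, hφ⟩ := h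
  have hmem : ∀ s ∈ timeInterval (T - ENNReal.ofReal t), t + s ∈ timeInterval T :=
    fun s hs => (mem_timeInterval_sub ht.1 hs.1).1 hs
  refine ⟨tsub_pos_of_lt ht.2, fun s => g (t + s), fun s hs => hgr _ (hmem s hs), ?_,
    fun s hs => ?_⟩
  · refine locallyIntegrableOn_timeInterval_iff.2 fun s hs => ?_
    have h1 := (intervalIntegrable_of_timeInterval hg ht (hmem s hs)).comp_add_left t
    rw [sub_self, add_sub_cancel_left] at h1
    exact (intervalIntegrable_iff_integrableOn_Icc_of_le hs.1).1 h1
  · have h0 := zero_mem_timeInterval hT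
    show φ (t + s) = φ t + ∫ s in (0 : ℝ)..s, g (t + s)
    rw [hφ _ (hmem s hs), hφ t ht, intervalIntegral.integral_comp_add_left, add_zero, add_assoc,
      intervalIntegral.integral_add_adjacent_intervals
        (intervalIntegrable_of_timeInterval hg h0 ht)
        (intervalIntegrable_of_timeInterval hg ht (hmem s hs))]

/-- Gluing all local solutions, which agree by uniqueness, gives a solution on the largest
possible interval. -/
theorem WellPosed.exists_maximal (hwp : N.WellPosed) (x₀ : lp E ∞) (hu : IsInput u) :
    ∃ T φ, N.IsSolution x₀ u T φ ∧ ∀ T' φ', N.IsSolution x₀ u T' φ' →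
      T' ≤ T ∧ EqOn φ φ' (timeInterval T') := by
  obtain ⟨⟨T₁, φ₁, h₁⟩, huniq⟩ := hwp x₀ u hu
  set T := sSup {T | ∃ φ, N.IsSolution x₀ u T φ} with hT
  have hmemT : ∀ t ∈ timeInterval T, ∃ T' φ', N.IsSolution x₀ u T' φ' ∧ t ∈ timeInterval T' := by
    rintro t ⟨ht0, htT⟩
    obtain ⟨T', ⟨φ', h'⟩, hlt⟩ := lt_sSup_iff.1 htT
    exact ⟨T', φ', h', ht0, hlt⟩
  have hglue : ∀ t, ∃ y, ∀ T' φ', N.IsSolution x₀ u T' φ' → t ∈ timeInterval T' → y = φ' t := by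
    intro t
    by_cases h : ∃ T' φ', N.IsSolution x₀ u T' φ' ∧ t ∈ timeInterval T'
    · obtain ⟨T', φ', h', ht'⟩ := h
      exact ⟨φ' t, fun T'' φ'' h'' ht'' => huniq _ _ _ _ h' h'' ⟨ht', ht''⟩⟩
    · exact ⟨0, fun T' φ' h' ht' => absurd ⟨T', φ', h', ht'⟩ h⟩
  choose φ hφ using hglue
  have hrhs : ∀ t, ∃ y : lp E ∞, t ∈ timeInterval T → ∀ i, y i = N.rhs (φ t) (u t) i := by
    intro t
    by_cases ht : t ∈ timeInterval T
    · obtain ⟨T', φ', h', ht'⟩ := hmemT t ht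
      obtain ⟨-, g', hgr', -, -⟩ := id h'
      exact ⟨g' t, fun _ i => by rw [hgr' t ht', hφ t T' φ' h' ht']⟩
    · exact ⟨0, fun h => absurd h ht⟩
  choose g hg using hrhs
  have hle : ∀ T' φ', N.IsSolution x₀ u T' φ' → T' ≤ T := fun T' φ' h' => le_sSup ⟨φ', h'⟩
  refine ⟨T, φ, ⟨h₁.1.trans_le (hle T₁ φ₁ h₁), g, fun s hs => hg s hs, ?_, fun t ht => ?_⟩,
    fun T' φ' h' => ⟨hle T' φ' h', fun t ht => hφ t T' φ' h' ht⟩⟩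
  all_goals
    have hloc : ∀ t ∈ timeInterval T, IntegrableOn g (Icc 0 t) ∧
        φ t = x₀ + ∫ s in (0 : ℝ)..t, g s := by
      intro t ht
      obtain ⟨T', φ', h', ht'⟩ := hmemT t ht
      obtain ⟨-, g', hgr', hg', hφ'⟩ := id h'
      have heq : EqOn g' g (Icc 0 t) := fun s hs => by
        have hs' := Icc_subset_timeInterval ht' hs
        refine lp.ext (funext fun i => ?_)
        rw [hgr' s hs', hg s (Icc_subset_timeInterval ht hs), hφ s T' φ' h' hs']
      refine ⟨(locallyIntegrableOn_timeInterval_iff.1 hg' t ht').congr_fun heq measurableSet_Icc,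
        ?_⟩
      rw [hφ t T' φ' h' ht', hφ' t ht']
      congr 1
      exact intervalIntegral.integral_congr (by rwa [uIcc_of_le ht.1])
  · exact locallyIntegrableOn_timeInterval_iff.2 fun t ht => (hloc t ht).1
  · exact (hloc t ht).2

end Network

/-! ### The supremum of the subsystem Lyapunov functions -/

section SupLyapunov

variable {E : ℕ → Type*} [∀ i, NormedAddCommGroup (E i)] {V : ∀ i, E i → ℝ≥0} {s : posCone}

theorem nnnorm_coord_le (x : lp E ∞) (i : ℕ) : ‖x i‖₊ ≤ ‖x‖₊ :=
  lp.norm_apply_le_norm ENNReal.top_ne_zero x i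

theorem bddAbove_supLyapunov {ψ : ℝ≥0 → ℝ≥0} (hψ : Monotone ψ) (hV : ∀ i z, V i z ≤ ψ ‖z‖₊)
    (hs : ∀ i, 1 ≤ coord s i) (x : lp E ∞) :
    ψ ‖x‖₊ ∈ upperBounds (range fun i => 1 / coord s i * V i (x i)) := by
  rintro _ ⟨i, rfl⟩
  have h1 : 1 / coord s i ≤ 1 := div_le_one_of_le₀ (hs i) zero_le
  exact (mul_le_of_le_one_left zero_le h1).trans ((hV i _).trans (hψ (nnnorm_coord_le x i)))

theorem supLyapunov_le {ψ : ℝ≥0 → ℝ≥0} (hψ : Monotone ψ) (hV : ∀ i z, V i z ≤ ψ ‖z‖₊)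
    (hs : ∀ i, 1 ≤ coord s i) (x : lp E ∞) : supLyapunov V s x ≤ ψ ‖x‖₊ :=
  ciSup_le fun i => bddAbove_supLyapunov hψ hV hs x ⟨i, rfl⟩

theorem div_le_coe_supLyapunov {x : lp E ∞}
    (hb : BddAbove (range fun i => 1 / coord s i * V i (x i))) (i : ℕ) :
    (V i (x i) : ℝ) / coord s i ≤ supLyapunov V s x := by
  have h := le_ciSup hb i
  rw [one_div_mul_eq_div] at h
  exact_mod_cast h

theorem coe_supLyapunov_le {x : lp E ∞} {c : ℝ} (h : ∀ i, (V i (x i) : ℝ) / coord s i ≤ c) :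
    (supLyapunov V s x : ℝ) ≤ c := by
  have hc : 0 ≤ c := (by positivity : (0 : ℝ) ≤ (V 0 (x 0) : ℝ) / coord s 0).trans (h 0)
  lift c to ℝ≥0 using hc
  rw [NNReal.coe_le_coe]
  refine ciSup_le fun i => ?_
  rw [one_div_mul_eq_div]
  exact_mod_cast h i

/-- Coercivity: the supremum commutes with the continuous increasing lower bound `ψ`. -/
theorem le_supLyapunov {ψ : ℝ≥0 → ℝ≥0} (hψ : IsClassKinf ψ) (hV : ∀ i z, ψ ‖z‖₊ ≤ V i z)
    {M : ℝ≥0} (hs : ∀ i, 1 ≤ coord s i) (hM : ∀ i, coord s i ≤ M) {x : lp E ∞}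
    (hb : BddAbove (range fun i => 1 / coord s i * V i (x i))) :
    1 / M * ψ ‖x‖₊ ≤ supLyapunov V s x := by
  obtain ⟨e, he, -⟩ := hψ.exists_inverse
  have hM0 : 0 < M := one_pos.trans_le ((hs 0).trans (hM 0))
  rw [one_div_mul_eq_div, div_le_iff₀ hM0, ← he, ← OrderIso.le_symm_apply]
  have h : ‖x‖ ≤ (e.symm (supLyapunov V s x * M) : ℝ) := by
    refine lp.norm_le_of_forall_le NNReal.zero_le_coe fun i => ?_
    rw [← coe_nnnorm, NNReal.coe_le_coe, OrderIso.le_symm_apply, he]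
    have hi : V i (x i) / coord s i ≤ supLyapunov V s x := by
      exact_mod_cast div_le_coe_supLyapunov hb i
    rw [div_le_iff₀ (one_pos.trans_le (hs i))] at hi
    exact (hV i _).trans (hi.trans (mul_le_mul_of_nonneg_left (hM i) zero_le))
  exact_mod_cast h

/-- The uniform Lipschitz bound for the weighted components, on a ball. -/
theorem abs_div_sub_div_le {R L : ℝ} (hL : 0 ≤ L)
    (hLip : ∀ i, ∀ y ∈ Metric.ball (0 : E i) R, ∀ z ∈ Metric.ball (0 : E i) R,
      |(V i y : ℝ) - (V i z : ℝ)| ≤ L * ‖y - z‖)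
    (hs : ∀ i, 1 ≤ coord s i) {x y : lp E ∞} (hx : ‖x‖ < R) (hy : ‖y‖ < R) (i : ℕ) :
    |(V i (x i) : ℝ) / coord s i - (V i (y i) : ℝ) / coord s i| ≤ L * ‖x - y‖ := by
  have hs' : (1 : ℝ) ≤ coord s i := by exact_mod_cast hs i
  have hmem : ∀ z : lp E ∞, ‖z‖ < R → z i ∈ Metric.ball (0 : E i) R := fun z hz => by
    rw [mem_ball_zero_iff]
    exact (lp.norm_apply_le_norm ENNReal.top_ne_zero z i).trans_lt hz
  rw [← sub_div, abs_div, abs_of_pos (one_pos.trans_le hs')]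
  refine (div_le_self (abs_nonneg _) hs').trans ((hLip i _ (hmem x hx) _ (hmem y hy)).trans ?_)
  have h := lp.norm_apply_le_norm ENNReal.top_ne_zero (x - y) i
  rw [lp.coeFn_sub, Pi.sub_apply] at h
  gcongr

theorem dist_supLyapunov_le {R L : ℝ} (hL : 0 ≤ L)
    (hLip : ∀ i, ∀ y ∈ Metric.ball (0 : E i) R, ∀ z ∈ Metric.ball (0 : E i) R,
      |(V i y : ℝ) - (V i z : ℝ)| ≤ L * ‖y - z‖)
    (hs : ∀ i, 1 ≤ coord s i)
    (hb : ∀ x : lp E ∞, BddAbove (range fun i => 1 / coord s i * V i (x i)))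
    {x y : lp E ∞} (hx : ‖x‖ < R) (hy : ‖y‖ < R) :
    dist (supLyapunov V s x) (supLyapunov V s y) ≤ L * dist x y := by
  have key : ∀ x y : lp E ∞, ‖x‖ < R → ‖y‖ < R →
      (supLyapunov V s x : ℝ) ≤ supLyapunov V s y + L * ‖x - y‖ := fun x y hx hy =>
    coe_supLyapunov_le fun i => by
      have h1 := (abs_le.1 (abs_div_sub_div_le hL hLip hs hx hy i)).2
      have h2 := div_le_coe_supLyapunov (hb y) i
      linarith
  rw [NNReal.dist_eq, dist_eq_norm, abs_le]
  have h1 := key x y hx hy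
  have h2 := key y x hy hx
  rw [norm_sub_rev] at h2
  constructor <;> linarith

theorem lipschitzOnWith_supLyapunov
    (hLip : ∀ R : ℝ, 0 < R → ∃ L : ℝ, 0 < L ∧ ∀ i, ∀ y ∈ Metric.ball (0 : E i) R,
      ∀ z ∈ Metric.ball (0 : E i) R, |(V i y : ℝ) - (V i z : ℝ)| ≤ L * ‖y - z‖)
    (hs : ∀ i, 1 ≤ coord s i)
    (hb : ∀ x : lp E ∞, BddAbove (range fun i => 1 / coord s i * V i (x i)))
    {B : Set (lp E ∞)} (hB : Bornology.IsBounded B) :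
    ∃ L : ℝ≥0, LipschitzOnWith L (supLyapunov V s) B := by
  obtain ⟨R, hR0, hR⟩ := hB.exists_pos_norm_lt
  obtain ⟨L, hL, hLR⟩ := hLip R hR0
  refine ⟨⟨L, hL.le⟩, LipschitzOnWith.of_dist_le_mul fun x hx y hy => ?_⟩
  exact dist_supLyapunov_le hL.le hLR hs hb (hR x hx) (hR y hy)

theorem continuous_supLyapunov
    (hLip : ∀ R : ℝ, 0 < R → ∃ L : ℝ, 0 < L ∧ ∀ i, ∀ y ∈ Metric.ball (0 : E i) R,
      ∀ z ∈ Metric.ball (0 : E i) R, |(V i y : ℝ) - (V i z : ℝ)| ≤ L * ‖y - z‖)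
    (hs : ∀ i, 1 ≤ coord s i)
    (hb : ∀ x : lp E ∞, BddAbove (range fun i => 1 / coord s i * V i (x i))) :
    Continuous (supLyapunov V s) := by
  refine continuous_iff_continuousAt.2 fun x => ?_
  obtain ⟨L, hL⟩ := lipschitzOnWith_supLyapunov hLip hs hb (Metric.isBounded_ball (x := x) (r := 1))
  exact hL.continuousOn.continuousAt (Metric.ball_mem_nhds x one_pos)

end SupLyapunov

namespace Network

variable {E F : ℕ → Type*} [∀ i, NormedAddCommGroup (E i)] [∀ i, NormedAddCommGroup (F i)]
  [∀ i, NormedSpace ℝ (E i)]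

/-- If the derivative of `v` along the `i`-th component of a solution is at most `-a` up to time `t`,
then `v` has decreased by at least `a t`. -/
theorem IsSolution.le_sub_mul [∀ i, CompleteSpace (E i)] {N : Network E F} {x₀ : lp E ∞}
    {u : ℝ → lp F ∞} {T : ℝ≥0∞} {φ : ℝ → lp E ∞} (h : N.IsSolution x₀ u T φ) (hu : IsInput u)
    {i : ℕ} {v : E i → ℝ} (hv : Continuous v) {a t : ℝ} (ht : t ∈ timeInterval T)
    (hd : ∀ τ ∈ Ico 0 t, DifferentiableAt ℝ v (φ τ i))
    (hle : ∀ τ ∈ Ico 0 t, fderiv ℝ v (φ τ i) (N.rhs (φ τ) (u τ) i) ≤ -a) :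
    v (φ t i) ≤ v (x₀ i) - a * t := by
  have hsub := Icc_subset_timeInterval ht
  refine image_le_of_deriv_right_le_deriv_boundary (f := fun τ => v (φ τ i))
    (f' := fun τ => fderiv ℝ v (φ τ i) (N.rhs (φ τ) (u τ) i)) (a := 0) (b := t)
    (B := fun τ => v (x₀ i) - a * τ) (B' := fun _ => -a)
    ?_ (fun τ hτ => ?_) ?_ (by fun_prop) (fun τ hτ => ?_) hle (right_mem_Icc.2 ht.1)
  · exact hv.comp_continuousOn ((continuous_coord i).comp_continuousOn (h.continuousOn.mono hsub))
  · exact (hd τ hτ).hasFDerivAt.comp_hasDerivWithinAt τ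
      (h.hasDerivWithinAt hu (hsub ⟨hτ.1, hτ.2.le⟩) i)
  · simp [h.apply_zero]
  · simpa using (((hasDerivAt_id τ).const_mul a).const_sub (v (x₀ i))).hasDerivWithinAt

/-- The decrease of `V = sup_i V_i / s_i` along solutions. On a short time interval all weighted
components stay uniformly close to their initial values. Those starting at most `(1 - ε) V(x)`
remain below `V(x)` by a fixed margin. The others exceed both their gain terms, because
`Γ(s) ≤ l s` with `l < 1`, and therefore decrease at a common linear rate. -/
theorem diniDeriv_supLyapunov_le [∀ i, CompleteSpace (E i)] (N : Network E F)
    {V : ∀ i, E i → ℝ≥0} (hVcont : ∀ i, Continuous (V i))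
    (hVC1 : ∀ i, ContDiffOn ℝ 1 (fun z => (V i z : ℝ)) {0}ᶜ)
    {ψ : ℝ≥0 → ℝ≥0} (hψ : IsClassK ψ) (hVψ : ∀ i z, V i z ≤ ψ ‖z‖₊)
    {μ : ℕ → posCone → ℝ≥0∞} (hμ : ∀ i, IsMHAF (μ i)) {γ : ℕ → ℕ →₀ ℝ≥0}
    {γu : ℕ → ℝ≥0 → ℝ≥0} {α : ℕ → ℝ≥0 → ℝ≥0}
    (hL2 : ∀ i (x : lp E ∞) (u : lp F ∞),
      max (μ i (weighted (γ i) fun j => V j (x j))) (γu i ‖u i‖₊ : ℝ≥0∞)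
          < (V i (x i) : ℝ≥0∞) →
        fderiv ℝ (fun z => (V i z : ℝ)) (x i) (N.rhs x u i) ≤ -(α i (V i (x i)) : ℝ))
    {γmax : ℝ≥0 → ℝ≥0} (hγmax : Monotone γmax) (hγu : ∀ i r, γu i r ≤ γmax r)
    (hLip : ∀ R : ℝ, 0 < R → ∃ L : ℝ, 0 < L ∧ ∀ i, ∀ y ∈ Metric.ball (0 : E i) R,
      ∀ z ∈ Metric.ball (0 : E i) R, |(V i y : ℝ) - (V i z : ℝ)| ≤ L * ‖y - z‖)
    {s : posCone} (hs : ∀ i, 1 ≤ coord s i) {l M : ℝ≥0} (hl : l < 1)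
    (hsl : ∀ i, gainMap μ γ s i ≤ l * coord s i) (hM : ∀ i, coord s i ≤ M)
    {α' : ℝ≥0 → ℝ≥0} (hα' : ∀ i r w, 1 / 2 * r ≤ w → w ≤ 2 * M * r → α' r ≤ α i w)
    {x : lp E ∞} {u : ℝ → lp F ∞} (hu : IsInput u)
    (hx : 2 * γmax (inputNorm u) < supLyapunov V s x)
    {T : ℝ≥0∞} {φ : ℝ → lp E ∞} (hφ : N.IsSolution x u T φ) :
    diniDeriv (supLyapunov V s) φ x ≤
      ((-((1 / M * α' (supLyapunov V s x) : ℝ≥0) : ℝ) : ℝ) : EReal) := by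
  have hb : ∀ x : lp E ∞, BddAbove (range fun i => 1 / coord s i * V i (x i)) :=
    fun x => ⟨_, bddAbove_supLyapunov hψ.mono hVψ hs x⟩
  set r : ℝ≥0 := supLyapunov V s x with hr
  have hr0 : 0 < r := pos_of_gt hx
  have hr0' : (0 : ℝ) < r := hr0
  have hl' : (l : ℝ) < 1 := hl
  have hl0 : (0 : ℝ) ≤ l := l.2
  have hM1 : (1 : ℝ) ≤ M := by exact_mod_cast (hs 0).trans (hM 0)
  have hs1 : ∀ i, (1 : ℝ) ≤ coord s i := fun i => by exact_mod_cast hs i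
  have hsM : ∀ i, (coord s i : ℝ) ≤ M := fun i => by exact_mod_cast hM i
  have hV0 : ∀ i, V i 0 = 0 := fun i => by
    have := hVψ i 0
    rwa [nnnorm_zero, hψ.2.2, nonpos_iff_eq_zero] at this
  -- the margin: `l (1 + ε / 2) < 1 - 3 ε / 2` and `1 / 2 ≤ 1 - 3 ε / 2`
  set ε : ℝ := (1 - l) / 4 with hε
  have hε0 : 0 < ε := by rw [hε]; linarith
  have hε4 : ε ≤ 1 / 4 := by rw [hε]; linarith
  have hlε : (l : ℝ) = 1 - 4 * ε := by rw [hε]; ring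
  set a : ℝ := (α' r : ℝ) with ha
  have ha0 : 0 ≤ a := NNReal.zero_le_coe
  obtain ⟨L, hL, hLR⟩ := hLip (‖x‖ + 1) (by positivity)
  -- a time `b` up to which all weighted components change by at most `ε r / 2`
  obtain ⟨b, hb0, hbT, hclose⟩ : ∃ b > 0, b ∈ timeInterval T ∧ ∀ τ ∈ Icc 0 b, ∀ i,
      |(V i (φ τ i) : ℝ) / coord s i - (V i (x i) : ℝ) / coord s i| ≤ ε * r / 2 := by
    set δ : ℝ := min 1 (ε * r / 2 / L) with hδ
    have hδ0 : 0 < δ := lt_min one_pos (by positivity)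
    have h0 := zero_mem_timeInterval hφ.1
    obtain ⟨b₁, hb₁, h0b₁⟩ := exists_gt_mem_timeInterval h0
    have hc : ContinuousWithinAt φ (Ici 0) 0 :=
      (hφ.continuousOn 0 h0).mono_of_mem_nhdsWithin
        (mem_of_superset (Icc_mem_nhdsGE h0b₁) (Icc_subset_timeInterval hb₁))
    have hball := hc.eventually (Metric.ball_mem_nhds (φ 0) hδ0)
    obtain ⟨b₂, hb₂, hsub⟩ := mem_nhdsGE_iff_exists_Icc_subset.1 hball
    refine ⟨min b₁ b₂, lt_min h0b₁ hb₂,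
      Icc_subset_timeInterval hb₁ ⟨(lt_min h0b₁ hb₂).le, min_le_left _ _⟩, fun τ hτ i => ?_⟩
    have h1 : dist (φ τ) (φ 0) < δ := hsub ⟨hτ.1, hτ.2.trans (min_le_right _ _)⟩
    rw [hφ.apply_zero, dist_eq_norm] at h1
    have h2 : ‖φ τ‖ < ‖x‖ + 1 := by
      have : ‖φ τ‖ ≤ ‖φ τ - x‖ + ‖x‖ := by simpa using norm_add_le (φ τ - x) x
      linarith [min_le_left 1 (ε * r / 2 / L)]
    refine (abs_div_sub_div_le hL.le hLR hs h2 (lt_add_one _) i).trans ?_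
    have h3 : ‖φ τ - x‖ ≤ ε * r / 2 / L := h1.le.trans (min_le_right _ _)
    rwa [le_div_iff₀ hL, mul_comm] at h3
  have hVb : ∀ τ ∈ Icc 0 b, ∀ j, (V j (φ τ j) : ℝ) ≤ (1 + ε / 2) * r * coord s j := by
    intro τ hτ j
    rw [← div_le_iff₀ (one_pos.trans_le (hs1 j))]
    have h1 := (abs_le.1 (hclose τ hτ j)).2
    have h2 := div_le_coe_supLyapunov (hb x) j
    linarith
  -- the components which are almost maximal at time `0` decrease at rate `a`
  have hdec : ∀ i, (1 - ε) * r < (V i (x i) : ℝ) / coord s i → ∀ t ∈ Icc 0 b,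
      (V i (φ t i) : ℝ) ≤ V i (x i) - a * t := by
    intro i hi t ht
    have hlow : ∀ τ ∈ Icc 0 b, (1 - 3 * ε / 2) * r * coord s i < V i (φ τ i) := fun τ hτ => by
      rw [← lt_div_iff₀ (one_pos.trans_le (hs1 i))]
      have h1 := (abs_le.1 (hclose τ hτ i)).1
      linarith
    have hhalf : (1 / 2 : ℝ) * r ≤ (1 - 3 * ε / 2) * r * coord s i := by
      calc (1 / 2 : ℝ) * r ≤ (1 - 3 * ε / 2) * r := by gcongr; linarith
        _ ≤ _ := le_mul_of_one_le_right (mul_nonneg (by linarith) hr0'.le) (hs1 i)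
    refine hφ.le_sub_mul hu (v := fun z => (V i z : ℝ))
      (NNReal.continuous_coe.comp (hVcont i)) (Icc_subset_timeInterval hbT ht)
      (fun τ hτ => ?_) (fun τ hτ => ?_)
    · refine ((hVC1 i).differentiableOn one_ne_zero).differentiableAt
        (isOpen_compl_singleton.mem_nhds fun h0 => ?_)
      have h1 := hlow τ ⟨hτ.1, hτ.2.le.trans ht.2⟩
      rw [mem_singleton_iff.1 h0, hV0] at h1
      have h2 : (0 : ℝ) ≤ 1 / 2 * r := by positivity
      simp only [NNReal.coe_zero] at h1
      linarith
    · have hτ' : τ ∈ Icc 0 b := ⟨hτ.1, hτ.2.le.trans ht.2⟩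
      have h1 := hlow τ hτ'
      refine (hL2 i (φ τ) (u τ) (max_lt ?_ ?_)).trans (neg_le_neg ?_)
      · let c : ℝ≥0 := ⟨(1 + ε / 2) * r, by positivity⟩
        refine (aggregation_le hμ (c := c) (hsl i) fun j => ?_).trans_lt ?_
        · rw [← NNReal.coe_le_coe]
          exact hVb τ hτ' j
        · rw [ENNReal.coe_lt_coe, ← NNReal.coe_lt_coe]
          refine lt_of_le_of_lt ?_ h1
          show (1 + ε / 2) * r * (l * coord s i) ≤ _
          have h2 : (1 + ε / 2) * l ≤ 1 - 3 * ε / 2 := by rw [hlε]; nlinarith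
          calc (1 + ε / 2) * r * (l * coord s i) = (1 + ε / 2) * l * (r * coord s i) := by ring
            _ ≤ (1 - 3 * ε / 2) * (r * coord s i) := by gcongr
            _ = _ := by ring
      · rw [ENNReal.coe_lt_coe]
        have h2 : γu i ‖u τ i‖₊ ≤ γmax (inputNorm u) :=
          (hγu i _).trans (hγmax ((nnnorm_coord_le _ i).trans (hu.nnnorm_le hτ.1)))
        refine h2.trans_lt ?_
        rw [← NNReal.coe_lt_coe] at hx ⊢
        push_cast at hx
        linarith
      · rw [ha, NNReal.coe_le_coe]
        refine hα' i r _ ?_ ?_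
        · rw [← NNReal.coe_le_coe]
          push_cast
          linarith
        · rw [← NNReal.coe_le_coe]
          push_cast
          refine (hVb τ hτ' i).trans ?_
          calc (1 + ε / 2) * r * coord s i ≤ 2 * r * M := by
                gcongr
                · linarith
                · exact hsM i
            _ = 2 * M * r := by ring
  -- linear decrease of the supremum, for all sufficiently small times
  have hev : ∀ᶠ t in 𝓝[>] (0 : ℝ), (supLyapunov V s (φ t) : ℝ) ≤ r - a / M * t := by
    have h1 : ∀ᶠ t in 𝓝 (0 : ℝ), a / M * t < ε * r / 2 := by
      refine (continuous_const.mul continuous_id).tendsto' 0 0 (by simp) |>.eventually_lt_const ?_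
      positivity
    filter_upwards [nhdsWithin_le_nhds h1, Ioc_mem_nhdsGT hb0] with t ht1 ht2
    have ht : t ∈ Icc 0 b := ⟨ht2.1.le, ht2.2⟩
    refine coe_supLyapunov_le fun i => ?_
    rcases le_or_gt ((V i (x i) : ℝ) / coord s i) ((1 - ε) * r) with h | h
    · have h2 := (abs_le.1 (hclose t ht i)).2
      linarith
    · have h2 := hdec i h t ht
      have h3 := div_le_coe_supLyapunov (hb x) i
      have hsi := one_pos.trans_le (hs1 i)
      calc (V i (φ t i) : ℝ) / coord s i ≤ (V i (x i) - a * t) / coord s i := by gcongr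
        _ = V i (x i) / coord s i - a / coord s i * t := by ring
        _ ≤ r - a / M * t := by
            gcongr
            · exact ht.1
            · exact hsM i
  refine limsup_le_of_le (by isBoundedDefault) ?_
  filter_upwards [hev, self_mem_nhdsWithin] with t ht ht0
  rw [EReal.coe_le_coe_iff, div_le_iff₀ ht0]
  have : (((1 / M * α' r : ℝ≥0) : ℝ)) = a / M := by push_cast; ring
  rw [this]
  linarith

end Network

/-! ### From the Lyapunov function to input-to-state stability -/

namespace Network

variable {E F : ℕ → Type*} [∀ i, NormedAddCommGroup (E i)] [∀ i, NormedAddCommGroup (F i)]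
  [∀ i, NormedSpace ℝ (E i)] {N : Network E F}

/-- Restarting a solution at time `t` turns the Dini bound at time `0` into one at time `t`. The
comparison principle then bounds the Lyapunov function on the whole interval of existence. -/
theorem IsISSLyapunov.exists_bound {V : lp E ∞ → ℝ≥0} (hV : N.IsISSLyapunov V) :
    ∃ W γ, IsClassKL W ∧ (∀ s t, W s t ≤ s) ∧ IsClassK γ ∧
      ∀ (x : lp E ∞) (u : ℝ → lp F ∞), IsInput u → ∀ T φ, N.IsSolution x u T φ →
        ∀ t ∈ timeInterval T, V (φ t) ≤ max (W (V x) t.toNNReal) (γ (inputNorm u)) := by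
  obtain ⟨hc, -, γ, α, hγ, hα, hdec⟩ := hV
  obtain ⟨W, hW, hWle, hcomp⟩ := exists_classKL_comparison hα
  refine ⟨W, γ, hW, hWle, hγ, fun x u hu T φ hφ b hb => ?_⟩
  have h := hcomp (fun t => V (φ t)) (γ (inputNorm u)) b hb.1
    (hc.comp_continuousOn (hφ.continuousOn.mono (Icc_subset_timeInterval hb))) ?_
  · simpa only [hφ.apply_zero] using h
  · intro t ht hlt
    have htT := Icc_subset_timeInterval hb ⟨ht.1, ht.2.le⟩
    exact hdec (φ t) _ (hu.shift ht.1)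
      ((hγ.mono (hu.inputNorm_shift_le ht.1)).trans_lt hlt) _ _ (hφ.shift htT)

/-- A bounded maximal solution is global. -/
theorem forwardComplete_of_bounded (hwp : N.WellPosed) (hbic : N.BIC)
    (hbdd : ∀ (x : lp E ∞) (u : ℝ → lp F ∞), IsInput u → ∀ T φ, N.IsSolution x u T φ →
      Bornology.IsBounded (φ '' timeInterval T)) : N.ForwardComplete := by
  intro x u hu T φ hφ
  obtain ⟨S, Φ, hΦ, hmax⟩ := hwp.exists_maximal x hu
  have hS : S = ∞ := by
    by_contra hne
    obtain ⟨S', Φ', hlt, hΦ', -⟩ :=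
      hbic x u hu S Φ (lt_top_iff_ne_top.2 hne) hΦ (hbdd x u hu S Φ hΦ)
    exact absurd (hmax S' Φ' hΦ').1 hlt.not_ge
  subst hS
  exact ⟨Φ, hΦ, (hmax T φ hφ).2⟩

theorem IsISSLyapunov.iss {V : lp E ∞ → ℝ≥0} (hV : N.IsISSLyapunov V) (hwp : N.WellPosed)
    (hbic : N.BIC) : N.ISS := by
  obtain ⟨W, γ, hW, hWle, hγ, hbound⟩ := hV.exists_bound
  obtain ⟨-, ⟨ψ₁, ψ₂, hψ₁, hψ₂, hψ⟩, -⟩ := hV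
  obtain ⟨e, he, hesymm⟩ := hψ₁.exists_inverse
  have hnorm : ∀ x c, V x ≤ c → ‖x‖₊ ≤ e.symm c := fun x c hc => by
    rw [OrderIso.le_symm_apply, he]
    exact (hψ x).1.trans hc
  refine ⟨hwp, forwardComplete_of_bounded hwp hbic fun x u hu T φ hφ => ?_,
    fun s t => e.symm (W (ψ₂ s) t), fun r => e.symm (γ r), ⟨fun t => ?_, fun s hs => ?_⟩,
    hesymm.comp hγ, fun x u hu φ hφ t => ?_⟩
  · refine isBounded_iff_forall_norm_le.2 ⟨e.symm (max (V x) (γ (inputNorm u))), ?_⟩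
    rintro _ ⟨t, ht, rfl⟩
    exact_mod_cast hnorm _ _ ((hbound x u hu T φ hφ t ht).trans
      (max_le_max_right _ (hWle _ _)))
  · exact hesymm.comp ((hW.1 t).comp hψ₂.1)
  · have hs' : 0 < ψ₂ s := hψ₂.1.2.2.symm.trans_lt (hψ₂.1.2.1 hs)
    obtain ⟨h1, h2, h3⟩ := hW.2 _ hs'
    refine ⟨hesymm.1.comp h1, fun _ _ hlt => hesymm.2.1 (h2 hlt), ?_⟩
    have := (hesymm.1.tendsto 0).comp h3
    rwa [hesymm.2.2] at this
  · have ht : (t : ℝ) ∈ timeInterval ∞ := ⟨t.2, ENNReal.ofReal_lt_top⟩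
    have h := hbound x u hu ∞ φ hφ t ht
    rw [Real.toNNReal_coe] at h
    refine (hnorm _ _ (h.trans (max_le_max_right _ ((hW.1 t).mono (hψ x).2)))).trans ?_
    rw [hesymm.mono.map_max]
    exact max_le le_self_add le_add_self

end Network

end InfNet

theorem theorem1
    {E F : ℕ → Type*}
    [∀ i, NormedAddCommGroup (E i)] [∀ i, NormedSpace ℝ (E i)] [∀ i, FiniteDimensional ℝ (E i)]
    [∀ i, NormedAddCommGroup (F i)] [∀ i, NormedSpace ℝ (F i)] [∀ i, FiniteDimensional ℝ (F i)]
    (N : InfNet.Network E F)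
    -- (i)
    (hwp : N.WellPosed) (hbic : N.BIC)
    -- (ii): ISS Lyapunov functions of the subsystems, with uniform coercivity bounds
    (V : ∀ i, E i → ℝ≥0)
    (hVcont : ∀ i, Continuous (V i))
    (hVC1 : ∀ i, ContDiffOn ℝ 1 (fun z => (V i z : ℝ)) {0}ᶜ)
    (ψ₁ ψ₂ : ℕ → ℝ≥0 → ℝ≥0)
    (hψ₁ : ∀ i, InfNet.IsClassKinf (ψ₁ i)) (hψ₂ : ∀ i, InfNet.IsClassKinf (ψ₂ i))
    (hL1 : ∀ i (z : E i), ψ₁ i ‖z‖₊ ≤ V i z ∧ V i z ≤ ψ₂ i ‖z‖₊)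
    (μ : ℕ → InfNet.posCone → ℝ≥0∞) (hμ : ∀ i, InfNet.IsMHAF (μ i))
    (γ : ℕ → ℕ →₀ ℝ≥0) (hγ : ∀ i j, j ∉ N.nbr i → γ i j = 0)
    (γu : ℕ → ℝ≥0 → ℝ≥0) (hγu : ∀ i, InfNet.IsClassK (γu i))
    (α : ℕ → ℝ≥0 → ℝ≥0) (hα : ∀ i, InfNet.IsClassP (α i))
    (hL2 : ∀ i (x : lp E ∞) (u : lp F ∞),
      max (μ i (InfNet.weighted (γ i) fun j => V j (x j))) (γu i ‖u i‖₊ : ℝ≥0∞)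
          < (V i (x i) : ℝ≥0∞) →
        fderiv ℝ (fun z => (V i z : ℝ)) (x i) (N.rhs x u i) ≤ -(α i (V i (x i)) : ℝ))
    (hcoerc : ∃ ψ₁' ψ₂', InfNet.IsClassKinf ψ₁' ∧ InfNet.IsClassKinf ψ₂' ∧
      ∀ i r, ψ₁' r ≤ ψ₁ i r ∧ ψ₂ i r ≤ ψ₂' r)
    -- (iii)
    (hwd : InfNet.GainWellDefined μ γ)
    (hγmax : ∃ γmax, InfNet.IsClassK γmax ∧ ∀ i r, γu i r ≤ γmax r)
    -- (iv)
    (ρ : ℝ≥0∞) (hρ : InfNet.IsSpectralRadius (InfNet.gainOperator μ γ hwd) ρ) (hρ1 : ρ < 1)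
    -- (v)
    (hLip : ∀ R : ℝ, 0 < R → ∃ L : ℝ, 0 < L ∧ ∀ i, ∀ y ∈ Metric.ball (0 : E i) R,
      ∀ z ∈ Metric.ball (0 : E i) R, |(V i y : ℝ) - (V i z : ℝ)| ≤ L * ‖y - z‖)
    -- (vi)
    (hαmin : ∃ α', InfNet.IsClassP α' ∧ ∀ i r, α' r ≤ α i r) :
    (∃ s₀ : InfNet.posCone,
      (s₀ : InfNet.EllInf) ∈ interior InfNet.posCone ∧
      (∀ x : lp E ∞, BddAbove (Set.range fun i => 1 / InfNet.coord s₀ i * V i (x i))) ∧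
      N.IsISSLyapunov (InfNet.supLyapunov V s₀) ∧
      ∀ B : Set (lp E ∞), Bornology.IsBounded B →
        ∃ L : ℝ≥0, LipschitzOnWith L (InfNet.supLyapunov V s₀) B) ∧
    N.ISS := by
  have : ∀ i, CompleteSpace (E i) := fun i => FiniteDimensional.complete ℝ (E i)
  obtain ⟨ψ₁', ψ₂', hψ₁', hψ₂', hψ'⟩ := hcoerc
  obtain ⟨γmax, hγmaxK, hγmax⟩ := hγmax
  obtain ⟨αmin, hαminP, hαmin⟩ := hαmin
  obtain ⟨s, l, hl, hs, hsl⟩ := InfNet.exists_decay_point hμ hwd hρ hρ1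
  obtain ⟨M, hM⟩ : ∃ M : ℝ≥0, ∀ i, InfNet.coord s i ≤ M :=
    ⟨‖(s : InfNet.EllInf)‖₊, fun i => InfNet.coord_le_norm s i⟩
  have hM1 : 1 ≤ M := (hs 0).trans (hM 0)
  have hM0 : 0 < 1 / M := one_div_pos.2 (one_pos.trans_le hM1)
  have hlow : ∀ i (z : E i), ψ₁' ‖z‖₊ ≤ V i z := fun i z => (hψ' i _).1.trans (hL1 i z).1
  have hup : ∀ i (z : E i), V i z ≤ ψ₂' ‖z‖₊ := fun i z => (hL1 i z).2.trans (hψ' i _).2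
  have hb : ∀ x : lp E ∞, BddAbove (Set.range fun i => 1 / InfNet.coord s i * V i (x i)) :=
    fun x => ⟨_, InfNet.bddAbove_supLyapunov hψ₂'.1.mono hup hs x⟩
  obtain ⟨α', hα', hα'le⟩ := hαminP.exists_le_of_comparable (a := 1 / 2) (b := 2 * M)
    (by norm_num) (by
      calc (1 / 2 : ℝ≥0) ≤ 2 * 1 := by rw [← NNReal.coe_le_coe]; norm_num
        _ ≤ 2 * M := by gcongr)
  have hLyap : N.IsISSLyapunov (InfNet.supLyapunov V s) := by
    refine ⟨InfNet.continuous_supLyapunov hLip hs hb,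
      ⟨fun r => 1 / M * ψ₁' r, ψ₂', ⟨hψ₁'.1.const_mul hM0, ?_⟩, hψ₂', fun x =>
        ⟨InfNet.le_supLyapunov hψ₁' hlow hs hM (hb x),
          InfNet.supLyapunov_le hψ₂'.1.mono hup hs x⟩⟩,
      fun r => 2 * γmax r, fun r => 1 / M * α' r, hγmaxK.const_mul two_pos,
      ⟨continuous_const.mul hα'.1, by simp [hα'.2.1], fun r hr => mul_pos hM0 (hα'.2.2 r hr)⟩,
      fun x u hu hx T φ hφ => ?_⟩
    · exact hψ₁'.2.const_mul_atTop hM0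
    · exact N.diniDeriv_supLyapunov_le hVcont hVC1 hψ₂'.1 hup hμ hL2 hγmaxK.mono hγmax hLip hs hl
        hsl hM (fun i r w h1 h2 => (hα'le r w h1 h2).trans (hαmin i w)) hu hx hφ
  exact ⟨⟨s, InfNet.mem_interior_posCone hs, hb, hLyap,
    fun B hB => InfNet.lipschitzOnWith_supLyapunov hLip hs hb hB⟩, hLyap.iss hwp hbic⟩
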